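/- Let $p>1$, let $f,g,\rho\in C[0,1]$ and $d\in C^1(0,1)$ be real functions such that: $\rho>0$ in $(0,1)$ and $\rho(0)=\rho(1)=0$; $g(0)>0$ and $\int_0^u g(s)\,ds>0$ for every $u\in(0,1]$; $d>0$ in $(0,1)$ and $\rho\, d^{1/(p-1)}\in L^1(0,1)$. For $c\in\mathbb R$, a travelling wave solution (t.w.s.) with speed $c$ is a function $u\in C^1(\alpha,\beta)$, $-\infty\le\alpha<\beta\le+\infty$, with $0<u<1$ in $(\alpha,\beta)$ and $d(u)|u'|^{p-2}u'\in C^1(\alpha,\beta)$, such that $$\bigl(d(u)|u'|^{p-2}u'\bigr)'+(c\,g(u)-f(u))\,u'+\rho(u)=0\quad\text{in }(\alpha,\beta),$$ $$\lim_{t\to\alpha^+}u(t)=1,\quad \lim_{t\to\beta^-}u(t)=0,\quad \lim_{t\to\alpha^+}d(u(t))|u'(t)|^{p-2}u'(t)=\lim_{t\to\beta^-}d(u(t))|u'(t)|^{p-2}u'(t)=0 .$$ Let $c^*$ be the minimal wave speed, that is, the infimum of all $c\in\mathbb R$ for which a t.w.s. with speed $c$ exists. **Theorem.** Assume that the limit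 $\ell_0:=\lim_{u\to0^+}\rho(u)\,\dfrac{d(u)^{1/(p-1)}}{u^{1/(p-1)}}$ exists and is finite. Let $u$ be a t.w.s. with speed $c\ge c^*$, defined in $(\alpha,\beta)$. Then: 1. If $\liminf_{v\to0^+}d(v)>0$ (possibly $+\infty$), then $\lim_{t\to\beta^-}u'(t)=0$. 2. If $\lim_{v\to0^+}d(v)=0$ and $\lim_{v\to0^+}\dfrac{d(v)}{v}=+\infty$, then $\lim_{t\to\beta^-}u'(t)=0$. 3. If $\lim_{v\to0^+}d(v)=0$ and the limit $\dot d(0):=\lim_{v\to0^+}\dfrac{d(v)}{v}$ exists with $0<\dot d(0)<+\infty$, then $$\lim_{t\to\beta^-}u'(t)=\begin{cases}-\left(\dfrac{c^*g(0)-f(0)}{\dot d(0)}\right)^{\frac1{p-1}}&\text{if }c=c^*,\\[2mm] 0&\text{if }c>c^*.\end{cases}$$ 4. If $\lim_{v\to0^+}d(v)=0$, the derivative $\dot d(v)=d'(v)$ satisfies $\lim_{v\to0^+}\dot d(v)=0$, and $c\,g(0)-f(0)\ne0$, then $$\lim_{t\to\beta^-}u'(t)=\begin{cases}-\infty&\text{if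 }c=c^*,\\ 0&\text{if }c>c^*.\end{cases}$$ -/

import Mathlib

open Set Filter Topology MeasureTheory

namespace PLaplaceWave

/-- The standing assumptions on the data of the reaction-diffusion-advection equation
`f(u) u_x + g(u) u_τ = [d(u) |u_x|^(p-2) u_x]_x + ρ(u)`.
Only the values of `f`, `g`, `ρ` on `[0,1]` and of `d` on `(0,1)` play a role. -/
structure StructuralHypotheses (p : ℝ) (f g ρ d : ℝ → ℝ) : Prop where
  one_lt_p : 1 < p
  continuousOn_f : ContinuousOn f (Icc 0 1)
  continuousOn_g : ContinuousOn g (Icc 0 1)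
  continuousOn_ρ : ContinuousOn ρ (Icc 0 1)
  contDiffOn_d : ContDiffOn ℝ 1 d (Ioo 0 1)
  ρ_pos : ∀ u ∈ Ioo (0 : ℝ) 1, 0 < ρ u
  ρ_zero : ρ 0 = 0
  ρ_one : ρ 1 = 0
  g_zero_pos : 0 < g 0
  integral_g_pos : ∀ u ∈ Ioc (0 : ℝ) 1, 0 < ∫ s in (0 : ℝ)..u, g s
  d_pos : ∀ u ∈ Ioo (0 : ℝ) 1, 0 < d u
  integrableOn : IntegrableOn (fun u => ρ u * d u ^ (1 / (p - 1))) (Ioo 0 1)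

/-- The open interval `(α, β)` of real numbers; the end points may be infinite. -/
def openInterval (α β : EReal) : Set ℝ := {t : ℝ | α < (t : EReal) ∧ (t : EReal) < β}

/-- The filter `t → β⁻` on `ℝ`: it is `𝓝[<] b` for `β = b` real and `atTop` for `β = +∞`. -/
noncomputable def leftLimit (β : EReal) : Filter ℝ := comap (fun t : ℝ => (t : EReal)) (𝓝[<] β)

/-- The filter `t → α⁺` on `ℝ`: it is `𝓝[>] a` for `α = a` real and `atBot` for `α = -∞`. -/
noncomputable def rightLimit (α : EReal) : Filter ℝ := comap (fun t : ℝ => (t : EReal)) (𝓝[>] α)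

/-- The flux `t ↦ d(u(t)) |u'(t)|^(p-2) u'(t)`. (It is `0` where `u'(t) = 0`.) -/
noncomputable def flux (p : ℝ) (d u : ℝ → ℝ) (t : ℝ) : ℝ :=
  d (u t) * |deriv u t| ^ (p - 2) * deriv u t

/-- `u` is a travelling wave solution with speed `c`, defined on the
interval `(α, β)`. -/
structure IsTravelingWave (p : ℝ) (f g ρ d : ℝ → ℝ) (c : ℝ) (α β : EReal) (u : ℝ → ℝ) :
    Prop where
  lt : α < β
  contDiffOn : ContDiffOn ℝ 1 u (openInterval α β)
  mem_Ioo : ∀ t ∈ openInterval α β, u t ∈ Ioo (0 : ℝ) 1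
  contDiffOn_flux : ContDiffOn ℝ 1 (flux p d u) (openInterval α β)
  equation : ∀ t ∈ openInterval α β,
    deriv (flux p d u) t + (c * g (u t) - f (u t)) * deriv u t + ρ (u t) = 0
  tendsto_left : Tendsto u (rightLimit α) (𝓝 1)
  tendsto_right : Tendsto u (leftLimit β) (𝓝 0)
  flux_left : Tendsto (flux p d u) (rightLimit α) (𝓝 0)
  flux_right : Tendsto (flux p d u) (leftLimit β) (𝓝 0)

/-- The set of admissible wave speeds. -/
def admissibleSpeeds (p : ℝ) (f g ρ d : ℝ → ℝ) : Set ℝ :=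
  {c : ℝ | ∃ (α β : EReal) (u : ℝ → ℝ), IsTravelingWave p f g ρ d c α β u}

/-- The threshold wave speed `c*`: the infimum of the admissible wave speeds. -/
noncomputable def minimalSpeed (p : ℝ) (f g ρ d : ℝ → ℝ) : ℝ :=
  sInf (admissibleSpeeds p f g ρ d)

end PLaplaceWave

/-! Write `s = 1/(p-1)`. A wave is strictly decreasing, so minus its flux is a function `y` of `v =
u(t)`. Dividing the equation by `u'` gives `y' = h - q y^(-s)` on `(0,1)`, with `h = c g - f` and `q
= ρ d^s`, and `y` vanishes at both ends (`IsTravelingWave.exists_isProfile`). Conversely, every such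
profile yields a wave (`IsProfile.exists_isTravelingWave`). Since `u' = -(y/d)^s`, everything
reduces to the limit of `y/d` at `0⁺`.

The first two cases need only `y → 0` and `y = O(v)`. In the last two, `q/v^s → 0`; let `H = h(0)`.
If `H > 0`, linear barriers show that `y/v` tends to `0` or to `H`
(`IsProfile.eventually_le_mul_or_tendsto_div`), and the minimal speed is characterised by the slope
`H`: - for `c > c*`, take the profile `z` of a smaller speed `c₁`. Slope `H` would put `y` above `z`
near `0`, and then `y - z ≥ ∫ (c - c₁) g` all the way to `1`, where both vanish
(`IsProfile.not_tendsto_div`); - for `c = c*`, a profile of smaller slope would survive a small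
decrease of `c` (`IsProfile.exists_perturbation`), contradicting minimality.

The perturbation works because `-q y^(-s)` increases with `y`: solutions do not drift apart
backwards in `v`. When `d' → 0` and `c > c*`, the barrier `ε d` replaces `ε v` and gives `y = o(d)`.
-/

namespace PLaplaceWave

/-! ### Differential inequalities -/

lemma nonpos_of_hasDerivAt_neg_of_eq_zero {φ φ' : ℝ → ℝ} {a b : ℝ}
    (hd : ∀ t ∈ Icc a b, HasDerivAt φ (φ' t) t) (ha : φ a ≤ 0)
    (h : ∀ t ∈ Ico a b, φ t = 0 → φ' t < 0) : ∀ t ∈ Icc a b, φ t ≤ 0 := by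
  intro t ht
  exact image_le_of_deriv_right_lt_deriv_boundary (B := fun _ => 0) (B' := fun _ => 0)
    (fun x hx => (hd x hx).continuousAt.continuousWithinAt)
    (fun x hx => (hd x (Ico_subset_Icc_self hx)).hasDerivWithinAt) ha
    (fun x => hasDerivAt_const _ _) h ht

lemma le_of_hasDerivWithinAt_nonneg_of_pos {φ φ' : ℝ → ℝ} {a b : ℝ} (hab : a ≤ b)
    (hc : ContinuousOn φ (Icc a b))
    (hd : ∀ t ∈ Ico a b, HasDerivWithinAt φ (φ' t) (Ici t) t) (ha : 0 < φ a)
    (h : ∀ t ∈ Ico a b, 0 < φ t → 0 ≤ φ' t) : φ a ≤ φ b := by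
  by_contra! hlt
  rcases hab.eq_or_lt with rfl | hab'
  · exact lt_irrefl _ hlt
  have hba : 0 < b - a := by linarith
  -- The line from `φ a` down to `φ a - m` is the barrier: it stays positive, ends above `φ b`, and
  -- its strictly negative slope supplies the strict inequality at contact points.
  obtain ⟨m, hm1, hm2⟩ : ∃ m, 0 < m ∧ m < φ a ∧ m < φ a - φ b := by
    refine ⟨min (φ a) (φ a - φ b) / 2, ?_⟩
    have : 0 < min (φ a) (φ a - φ b) := lt_min ha (by linarith)
    have h1 := min_le_left (φ a) (φ a - φ b)
    have h2 := min_le_right (φ a) (φ a - φ b)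
    exact ⟨by linarith, by linarith, by linarith⟩
  have key := image_le_of_deriv_right_lt_deriv_boundary (f := fun t => -φ t)
    (f' := fun t => -φ' t) (B := fun t => -φ a + m / (b - a) * (t - a))
    (B' := fun _ => m / (b - a)) (a := a) (b := b) hc.neg (fun t ht => (hd t ht).neg) (by simp)
    (fun t => by
      simpa using (((hasDerivAt_id t).sub_const a).const_mul (m / (b - a))).const_add (-φ a))
    (fun t ht he => by
      have hmb : 0 < m / (b - a) := div_pos hm1 hba
      have h1 : m / (b - a) * (t - a) ≤ m / (b - a) * (b - a) :=
        mul_le_mul_of_nonneg_left (by linarith [ht.2]) hmb.le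
      rw [div_mul_cancel₀ _ hba.ne'] at h1
      have := h t ht (by linarith)
      linarith) (right_mem_Icc.2 hab)
  simp only [div_mul_cancel₀ _ hba.ne'] at key
  linarith

/-! ### The singular equation: comparison, existence, perturbation -/

lemma exists_lipschitzOnWith_rpow_neg (s : ℝ) {m : ℝ} (hm : 0 < m) (hs : 0 < s) :
    ∃ K : NNReal, LipschitzOnWith K (fun x : ℝ => x ^ (-s)) (Ici m) := by
  refine ⟨(s * m ^ (-s - 1)).toNNReal, ?_⟩
  refine Convex.lipschitzOnWith_of_nnnorm_deriv_le (𝕜 := ℝ) (fun x hx => ?_) (fun x hx => ?_)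
    (convex_Ici m)
  · exact (Real.hasDerivAt_rpow_const (Or.inl (hm.trans_le hx).ne')).differentiableAt
  · have hx0 : 0 < x := hm.trans_le hx
    rw [(Real.hasDerivAt_rpow_const (Or.inl hx0.ne')).deriv, ← NNReal.coe_le_coe, coe_nnnorm,
      Real.coe_toNNReal _ (by positivity), Real.norm_eq_abs, abs_mul, abs_neg, abs_of_pos hs,
      abs_of_pos (Real.rpow_pos_of_pos hx0 _)]
    exact mul_le_mul_of_nonneg_left (Real.rpow_le_rpow_of_nonpos hm hx (by linarith)) hs.le

/-- The positive solutions on `S` of the singular equation `y' = h(v) - q(v) y ^ (-s)`. -/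
def IsPositiveSolutionOn (s : ℝ) (h q y : ℝ → ℝ) (S : Set ℝ) : Prop :=
  ∀ v ∈ S, 0 < y v ∧ HasDerivWithinAt y (h v - q v * y v ^ (-s)) S v

section SingularEquation

variable {s : ℝ} {h k q y z : ℝ → ℝ} {a b : ℝ}

namespace IsPositiveSolutionOn

lemma mono {S T : Set ℝ} (hy : IsPositiveSolutionOn s h q y T) (hST : S ⊆ T) :
    IsPositiveSolutionOn s h q y S :=
  fun v hv => ⟨(hy v (hST hv)).1, (hy v (hST hv)).2.mono hST⟩

lemma continuousOn {S : Set ℝ} (hy : IsPositiveSolutionOn s h q y S) : ContinuousOn y S :=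
  fun v hv => (hy v hv).2.continuousWithinAt

lemma hasDerivAt {S : Set ℝ} (hy : IsPositiveSolutionOn s h q y S) (hS : IsOpen S) {v : ℝ}
    (hv : v ∈ S) : HasDerivAt y (h v - q v * y v ^ (-s)) v :=
  (hy v hv).2.hasDerivAt (hS.mem_nhds hv)

lemma hasDerivWithinAt_Ici (hy : IsPositiveSolutionOn s h q y (Icc a b)) {v : ℝ}
    (hv : v ∈ Ico a b) : HasDerivWithinAt y (h v - q v * y v ^ (-s)) (Ici v) v :=
  (hy v (Ico_subset_Icc_self hv)).2.mono_of_mem_nhdsWithin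
    (mem_of_superset (Icc_mem_nhdsGE_of_mem ⟨le_rfl, hv.2⟩) (Icc_subset_Icc_left hv.1))

/-- Backward comparison of solutions with different right-hand sides and terminal values. -/
lemma sub_le (hs : 0 < s) (hab : a ≤ b) (hq : ∀ v ∈ Icc a b, 0 < q v)
    (hy : IsPositiveSolutionOn s h q y (Icc a b)) (hz : IsPositiveSolutionOn s k q z (Icc a b))
    {η μ : ℝ} (hη : 0 ≤ η) (hμ : 0 ≤ μ) (hhk : ∀ v ∈ Icc a b, |h v - k v| ≤ η)
    (hb : y b - z b ≤ μ) : y a - z a ≤ μ + η * (b - a) := by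
  by_contra! hlt
  have := le_of_hasDerivWithinAt_nonneg_of_pos (φ := fun v => y v - z v - μ - η * (b - v))
    (φ' := fun v => (h v - q v * y v ^ (-s)) - (k v - q v * z v ^ (-s)) + η) hab
    (((hy.continuousOn.sub hz.continuousOn).sub continuousOn_const).sub (by fun_prop))
    (fun t ht => by
      have := (((hy.hasDerivWithinAt_Ici ht).sub (hz.hasDerivWithinAt_Ici ht)).sub_const μ).sub
        ((((hasDerivAt_id t).const_sub b).const_mul η).hasDerivWithinAt (s := Ici t))
      exact this.congr_deriv (by ring))
    (by linarith)
    (fun t ht hpos => by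
      have ht' := Ico_subset_Icc_self ht
      have h1 := abs_le.1 (hhk t ht')
      have h2 : z t ≤ y t := by
        have : 0 ≤ η * (b - t) := mul_nonneg hη (by linarith [ht.2])
        linarith
      have h3 : y t ^ (-s) ≤ z t ^ (-s) :=
        Real.rpow_le_rpow_of_nonpos (hz t ht').1 h2 (by linarith)
      have h4 := mul_le_mul_of_nonneg_left h3 (hq t ht').le
      linarith [h1.1])
  simp only [sub_self, mul_zero] at this
  linarith

lemma abs_sub_le (hs : 0 < s) (hab : a ≤ b) (hq : ∀ v ∈ Icc a b, 0 < q v)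
    (hy : IsPositiveSolutionOn s h q y (Icc a b)) (hz : IsPositiveSolutionOn s k q z (Icc a b))
    {η μ : ℝ} (hη : 0 ≤ η) (hμ : 0 ≤ μ) (hhk : ∀ v ∈ Icc a b, |h v - k v| ≤ η)
    (hb : |y b - z b| ≤ μ) : |y a - z a| ≤ μ + η * (b - a) := by
  have h1 := sub_le hs hab hq hy hz hη hμ hhk (abs_le.1 hb).2
  have h2 := sub_le hs hab hq hz hy hη hμ (fun v hv => abs_sub_comm (h v) (k v) ▸ hhk v hv)
    (by linarith [(abs_le.1 hb).1])
  exact abs_le.2 ⟨by linarith, by linarith⟩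

/-- Below the level `m` a solution decreases at rate at least `1`, so starting below `m` at some `v
≤ b` it would reach `0` before `b'`. The bound does not depend on the solution, which is what the
limit passage in `exists_perturbation` requires. -/
lemma le_of_forall_le_neg_one (hs : 0 < s) {b' m : ℝ} (hbb : b < b')
    (hq : ∀ v ∈ Icc a b', 0 < q v) (hmb : m ≤ b' - b)
    (hneg : ∀ v ∈ Icc a b', h v - q v * m ^ (-s) ≤ -1)
    (hy : IsPositiveSolutionOn s h q y (Icc a b')) : ∀ v ∈ Icc a b, m ≤ y v := by
  intro v hv
  by_contra! hlt
  have hsub : Icc v b' ⊆ Icc a b' := Icc_subset_Icc_left hv.1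
  have hy' := hy.mono hsub
  have key := image_le_of_deriv_right_lt_deriv_boundary (f := y)
    (f' := fun t => h t - q t * y t ^ (-s)) (B := fun t => y v - (t - v))
    (B' := fun _ => -1) (a := v) (b := b') hy'.continuousOn
    (fun t ht => hy'.hasDerivWithinAt_Ici ht) (by simp)
    (fun t => by simpa using ((hasDerivAt_id t).sub_const v).const_sub (y v))
    (fun t ht he => by
      have ht' := Ico_subset_Icc_self ht
      have h1 : y t < m := by linarith [ht.1]
      have h3 : m ^ (-s) < y t ^ (-s) := Real.rpow_lt_rpow_of_neg (hy' t ht').1 h1 (by linarith)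
      have h4 := mul_lt_mul_of_pos_left h3 (hq t (hsub ht'))
      linarith [hneg t (hsub ht')]) (right_mem_Icc.2 (hv.2.trans hbb.le))
  have := (hy b' (right_mem_Icc.2 (hv.1.trans (hv.2.trans hbb.le)))).1
  linarith [hv.2]

end IsPositiveSolutionOn

lemma exists_pos_forall_le_neg_one (hs : 0 < s) (hab : a ≤ b)
    (hk : ContinuousOn k (Icc a b)) (hqc : ContinuousOn q (Icc a b))
    (hq : ∀ v ∈ Icc a b, 0 < q v) {M : ℝ} (hM : 0 < M) :
    ∃ m, 0 < m ∧ m < M ∧ ∀ v ∈ Icc a b, k v - q v * m ^ (-s) ≤ -1 := by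
  obtain ⟨v₁, h₁, hv₁⟩ := isCompact_Icc.exists_isMinOn (nonempty_Icc.2 hab) hqc
  obtain ⟨v₂, h₂, hv₂⟩ := isCompact_Icc.exists_isMaxOn (nonempty_Icc.2 hab) hk
  have h3 : Tendsto (fun m : ℝ => k v₂ - q v₁ * m ^ (-s)) (𝓝[>] 0) atBot := by
    have := (tendsto_rpow_neg_nhdsGT_zero (y := -s) (by linarith)).const_mul_atTop (hq v₁ h₁)
    simpa [sub_eq_add_neg] using
      tendsto_atBot_add_const_left _ (k v₂) (tendsto_neg_atTop_atBot.comp this)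
  obtain ⟨m, hm, hm1, hm2⟩ := ((h3.eventually_le_atBot (-1)).and
    (Ioo_mem_nhdsGT hM)).exists
  refine ⟨m, hm1, hm2, fun v hv => ?_⟩
  have h4 := hv₂ hv
  have h5 := mul_le_mul_of_nonneg_right (hv₁ hv : q v₁ ≤ q v) (Real.rpow_nonneg hm1.le (-s))
  change k v ≤ k v₂ at h4
  linarith

/-- Replacing `x` by `max x m` makes the field bounded and globally Lipschitz, so Picard–Lindelöf
solves backwards from `b` over the whole interval. The truncation is never active: below `m` the
solution decreases, so it could not climb back to `Y > m` at `b`. -/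
lemma exists_isPositiveSolutionOn_Icc (hs : 0 < s) (hab : a < b)
    (hk : ContinuousOn k (Icc a b)) (hqc : ContinuousOn q (Icc a b))
    (hq : ∀ v ∈ Icc a b, 0 < q v) {Y : ℝ} (hY : 0 < Y) :
    ∃ z, IsPositiveSolutionOn s k q z (Icc a b) ∧ z b = Y := by
  obtain ⟨m, hm, hmY, hneg⟩ := exists_pos_forall_le_neg_one hs hab.le hk hqc hq hY
  obtain ⟨K, hK⟩ := exists_lipschitzOnWith_rpow_neg s hm hs
  obtain ⟨A, hA⟩ := isCompact_Icc.exists_bound_of_continuousOn hk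
  obtain ⟨Q, hQ⟩ := isCompact_Icc.exists_bound_of_continuousOn hqc
  have hb : b ∈ Icc a b := right_mem_Icc.2 hab.le
  have hA0 : 0 ≤ A := (norm_nonneg _).trans (hA b hb)
  have hQ0 : 0 ≤ Q := (norm_nonneg _).trans (hQ b hb)
  set L : ℝ := A + Q * m ^ (-s) with hL
  have hL0 : 0 ≤ L := by positivity
  have hpl : IsPicardLindelof (fun v x : ℝ => k v - q v * (max x m) ^ (-s))
      (⟨b, hb⟩ : Icc a b) Y (L * (b - a)).toNNReal 0 L.toNNReal (Q.toNNReal * K) := by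
    refine ⟨fun v hv => LipschitzOnWith.of_dist_le_mul fun x _ x' _ => ?_, fun x _ => ?_,
      fun v hv x _ => ?_, ?_⟩
    · have h1 := hK.dist_le_mul (max x m) (mem_Ici.2 (le_max_right _ _)) (max x' m)
        (mem_Ici.2 (le_max_right _ _))
      have h2 : dist (max x m) (max x' m) ≤ dist x x' := by
        simpa [Real.dist_eq] using abs_max_sub_max_le_abs x x' m
      have h3 : dist (k v - q v * (max x m) ^ (-s)) (k v - q v * (max x' m) ^ (-s))
          = |q v| * dist ((max x m) ^ (-s)) ((max x' m) ^ (-s)) := by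
        rw [dist_sub_left, Real.dist_eq, Real.dist_eq, ← mul_sub, abs_mul]
      rw [h3, NNReal.coe_mul, Real.coe_toNNReal _ hQ0, mul_assoc]
      gcongr
      · exact hQ v hv
      · exact h1.trans (by gcongr)
    · exact hk.sub (hqc.mul continuousOn_const)
    · rw [Real.coe_toNNReal _ hL0]
      refine (norm_sub_le _ _).trans ?_
      rw [norm_mul, hL]
      have hmx : 0 < max x m := lt_max_of_lt_right hm
      gcongr
      · exact hA v hv
      · exact hQ v hv
      · rw [Real.norm_eq_abs, abs_of_pos (by positivity)]
        exact Real.rpow_le_rpow_of_nonpos hm (le_max_right _ _) (by linarith)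
    · have : 0 ≤ b - a := by linarith
      rw [Real.coe_toNNReal _ hL0, Real.coe_toNNReal _ (by positivity)]
      simp [this]
  obtain ⟨z, hzb, hz⟩ := hpl.exists_eq_forall_mem_Icc_hasDerivWithinAt₀
  simp only at hzb
  have hge : ∀ v ∈ Icc a b, m ≤ z v := by
    intro v hv
    by_contra! hlt
    have hsub : Icc v b ⊆ Icc a b := Icc_subset_Icc_left hv.1
    have key := image_le_of_deriv_right_lt_deriv_boundary (f := z)
      (f' := fun t => k t - q t * (max (z t) m) ^ (-s)) (B := fun _ => z v)
      (B' := fun _ => 0) (a := v) (b := b)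
      (fun t ht => ((hz t (hsub ht)).mono hsub).continuousWithinAt)
      (fun t ht => (hz t (hsub (Ico_subset_Icc_self ht))).mono_of_mem_nhdsWithin
        (mem_of_superset (Icc_mem_nhdsGE_of_mem ⟨le_rfl, ht.2⟩)
          (Icc_subset_Icc_left (hv.1.trans ht.1)))) le_rfl
      (fun t => hasDerivAt_const _ _)
      (fun t ht he => by
        rw [he, max_eq_right hlt.le]
        linarith [hneg t (hsub (Ico_subset_Icc_self ht))]) (right_mem_Icc.2 hv.2)
    linarith
  refine ⟨z, fun v hv => ⟨hm.trans_le (hge v hv), ?_⟩, hzb⟩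
  simpa only [max_eq_left (hge v hv)] using hz v hv

/-- A positive solution on `(0, 1)` is stable under a bounded perturbation of the right-hand
side. -/
lemma IsPositiveSolutionOn.exists_perturbation (hs : 0 < s)
    (hk : ContinuousOn k (Ioo 0 1)) (hqc : ContinuousOn q (Ioo 0 1))
    (hq : ∀ v ∈ Ioo (0 : ℝ) 1, 0 < q v) (hy : IsPositiveSolutionOn s h q y (Ioo 0 1))
    {η : ℝ} (hη : 0 ≤ η) (hhk : ∀ v ∈ Ioo (0 : ℝ) 1, |k v - h v| ≤ η) :
    ∃ z, IsPositiveSolutionOn s k q z (Ioo 0 1) ∧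
      ∀ v ∈ Ioo (0 : ℝ) 1, |z v - y v| ≤ η * (1 - v) := by
  -- The perturbed equation is solved on the exhausting intervals `[e n, 1 - e n]`, starting from
  -- the value of `y` at the right end. The shift by `3` keeps `e n < 1/2`.
  set e : ℕ → ℝ := fun n => 1 / ((n : ℝ) + 3) with he
  have he0 : ∀ n, 0 < e n := fun n => by positivity
  have he1 : ∀ n, e n < 1 / 2 := fun n => by
    simp only [he]
    rw [div_lt_div_iff₀ (by positivity) (by norm_num)]
    have : (0 : ℝ) ≤ n := n.cast_nonneg
    linarith
  have hmono : ∀ {n m}, n ≤ m → e m ≤ e n := fun {n m} hnm => by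
    simp only [he]
    have : (n : ℝ) ≤ m := by exact_mod_cast hnm
    gcongr
  have hlim : Tendsto e atTop (𝓝 0) := by
    have h1 : Tendsto (fun n : ℕ => (n : ℝ) + 3) atTop atTop :=
      tendsto_atTop_add_const_right _ _ tendsto_natCast_atTop_atTop
    simpa only [he, one_div] using! h1.inv_tendsto_atTop
  have hsub : ∀ n, Icc (e n) (1 - e n) ⊆ Ioo 0 1 := fun n v hv =>
    ⟨(he0 n).trans_le hv.1, by linarith [hv.2, he0 n]⟩
  have hex : ∀ n, ∃ z, IsPositiveSolutionOn s k q z (Icc (e n) (1 - e n)) ∧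
      z (1 - e n) = y (1 - e n) := fun n =>
    exists_isPositiveSolutionOn_Icc hs (by linarith [he1 n]) (hk.mono (hsub n))
      (hqc.mono (hsub n)) (fun v hv => hq v (hsub n hv))
      (hy _ ⟨by linarith [he1 n], by linarith [he0 n]⟩).1
  choose z hz hzb using hex
  have hzy : ∀ n, ∀ v ∈ Icc (e n) (1 - e n), |z n v - y v| ≤ η * (1 - e n - v) := by
    intro n v hv
    have hsub' : Icc v (1 - e n) ⊆ Icc (e n) (1 - e n) := Icc_subset_Icc_left hv.1
    have := IsPositiveSolutionOn.abs_sub_le hs hv.2 (fun t ht => hq t (hsub n (hsub' ht)))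
      ((hz n).mono hsub') (hy.mono (hsub'.trans (hsub n))) hη le_rfl
      (fun t ht => hhk t (hsub n (hsub' ht))) (by simp [hzb])
    linarith
  -- At `1 - e n`, `z m` is within `η * e n` of `y`, hence of `z n`. Both solve the same equation,
  -- so this gap does not grow backwards, and the sequence is uniformly Cauchy.
  have hzz : ∀ {n m}, n ≤ m → ∀ v ∈ Icc (e n) (1 - e n), |z n v - z m v| ≤ η * e n := by
    intro n m hnm v hv
    have hem := hmono hnm
    have hsub' : Icc v (1 - e n) ⊆ Icc (e n) (1 - e n) := Icc_subset_Icc_left hv.1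
    have hsub'' : Icc (e n) (1 - e n) ⊆ Icc (e m) (1 - e m) :=
      Icc_subset_Icc hem (by linarith)
    have h1 := hzy m (1 - e n) (hsub'' (right_mem_Icc.2 (hv.1.trans hv.2)))
    rw [← hzb n, abs_sub_comm] at h1
    have h2 : η * (1 - e m - (1 - e n)) ≤ η * e n :=
      mul_le_mul_of_nonneg_left (by linarith [he0 m]) hη
    have := IsPositiveSolutionOn.abs_sub_le hs hv.2 (fun t ht => hq t (hsub n (hsub' ht)))
      ((hz n).mono hsub') ((hz m).mono (hsub'.trans hsub'')) le_rfl
      (mul_nonneg hη (he0 n).le) (fun t ht => by simp) (h1.trans h2)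
    simpa using this
  have hcov : ∀ {a b : ℝ}, 0 < a → b < 1 → ∀ᶠ n in atTop, Icc a b ⊆ Icc (e n) (1 - e n) := by
    intro a b ha hb
    filter_upwards [hlim.eventually_lt_const ha,
      hlim.eventually_lt_const (sub_pos.2 hb)] with n h1 h2
    exact Icc_subset_Icc h1.le (by linarith)
  have hηlim : Tendsto (fun n => η * e n) atTop (𝓝 0) := by simpa using hlim.const_mul η
  have hconv : ∀ v ∈ Ioo (0 : ℝ) 1, ∃ l, Tendsto (fun n => z n v) atTop (𝓝 l) := by
    intro v hv
    refine cauchySeq_tendsto_of_complete (Metric.cauchySeq_iff'.2 fun ε hε => ?_)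
    obtain ⟨N, hN, hN'⟩ := ((hcov hv.1 hv.2).and (hηlim.eventually_lt_const hε)).exists
    refine ⟨N, fun n hn => ?_⟩
    rw [dist_comm]
    exact (hzz hn v (hN ⟨le_rfl, le_rfl⟩)).trans_lt hN'
  choose! w hw using hconv
  have hzw : ∀ n, ∀ v ∈ Icc (e n) (1 - e n), |z n v - w v| ≤ η * e n := by
    intro n v hv
    refine le_of_tendsto ((tendsto_const_nhds.sub (hw v (hsub n hv))).abs)
      ((eventually_ge_atTop n).mono fun m hm => hzz hm v hv)
  -- A common positive lower bound on compact sets makes `x ^ (-s)` Lipschitz along the sequence, so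
  -- the derivatives converge uniformly. The room up to `(b + 1) / 2` is spent in
  -- `le_of_forall_le_neg_one`.
  have hlow : ∀ {a b : ℝ}, 0 < a → b < 1 → a ≤ b → ∃ m, 0 < m ∧
      (∀ᶠ n in atTop, ∀ v ∈ Icc a b, m ≤ z n v) ∧ ∀ v ∈ Icc a b, m ≤ w v := by
    intro a b ha hb hab
    have hb' : b < (b + 1) / 2 := by linarith
    have hI : Icc a ((b + 1) / 2) ⊆ Ioo 0 1 :=
      fun v hv => ⟨ha.trans_le hv.1, by linarith [hv.2]⟩
    obtain ⟨m, hm, hmM, hneg⟩ := exists_pos_forall_le_neg_one hs (hab.trans hb'.le) (hk.mono hI)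
      (hqc.mono hI) (fun v hv => hq v (hI hv)) (M := (b + 1) / 2 - b) (by linarith)
    have hev : ∀ᶠ n in atTop, ∀ v ∈ Icc a b, m ≤ z n v := by
      filter_upwards [hcov ha (by linarith : (b + 1) / 2 < 1)] with n hn
      exact IsPositiveSolutionOn.le_of_forall_le_neg_one hs hb'
        (fun v hv => hq v (hI hv)) hmM.le hneg ((hz n).mono hn)
    exact ⟨m, hm, hev, fun v hv => ge_of_tendsto
      (hw v ⟨ha.trans_le hv.1, hv.2.trans_lt hb⟩) (hev.mono fun n hn => hn v hv)⟩
  refine ⟨w, fun v hv => ?_, fun v hv => ?_⟩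
  · set a := v / 2 with ha
    set b := (v + 1) / 2 with hb
    have ha0 : 0 < a := by linarith [hv.1]
    have hb1 : b < 1 := by linarith [hv.2]
    have hvab : v ∈ Ioo a b := ⟨by linarith [hv.1], by linarith [hv.2]⟩
    have hab : a ≤ b := (hvab.1.trans hvab.2).le
    have hI : Icc a b ⊆ Ioo 0 1 := fun v hv => ⟨ha0.trans_le hv.1, hv.2.trans_lt hb1⟩
    obtain ⟨m, hm, hmz, hmw⟩ := hlow ha0 hb1 hab
    obtain ⟨K, hK⟩ := exists_lipschitzOnWith_rpow_neg s hm hs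
    obtain ⟨Q, hQ⟩ := isCompact_Icc.exists_bound_of_continuousOn (hqc.mono hI)
    have hQ0 : 0 ≤ Q := (norm_nonneg _).trans (hQ a (left_mem_Icc.2 hab))
    refine ⟨hm.trans_le (hmw v (Ioo_subset_Icc_self hvab)), HasDerivAt.hasDerivWithinAt ?_⟩
    refine hasDerivAt_of_tendstoUniformlyOn (f := z) (l := atTop) (s := Ioo a b)
      (f' := fun n t => k t - q t * z n t ^ (-s))
      (g' := fun t => k t - q t * w t ^ (-s)) isOpen_Ioo ?_ ?_
      (fun x hx => hw x (hI (Ioo_subset_Icc_self hx))) hvab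
    · rw [Metric.tendstoUniformlyOn_iff]
      intro ε hε
      have hlim' : Tendsto (fun n => Q * (K * (η * e n))) atTop (𝓝 0) := by
        simpa using (hηlim.const_mul (K : ℝ)).const_mul Q
      filter_upwards [hmz, hcov ha0 hb1, hlim'.eventually_lt_const hε] with n h1 h2 h3 x hx
      have hx' := Ioo_subset_Icc_self hx
      refine lt_of_le_of_lt ?_ h3
      rw [dist_comm, dist_sub_left, Real.dist_eq, ← mul_sub, abs_mul]
      gcongr
      · exact hQ x hx'
      · refine (hK.dist_le_mul _ (h1 x hx') _ (hmw x hx')).trans ?_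
        gcongr
        exact hzw n x (h2 hx')
    · filter_upwards [hcov ha0 hb1] with n hn x hx
      exact (hz n x (hn (Ioo_subset_Icc_self hx))).2.hasDerivAt
        (mem_of_superset (Icc_mem_nhds hx.1 hx.2) hn)
  · refine le_of_tendsto (((hw v hv).sub_const (y v)).abs) ?_
    filter_upwards [hcov hv.1 hv.2] with n hn
    refine (hzy n v (hn ⟨le_rfl, le_rfl⟩)).trans (mul_le_mul_of_nonneg_left ?_ hη)
    linarith [he0 n]

/-! ### Slopes of profiles at `0` -/

lemma eventually_le_mul_of_hasDerivAt_le {y y' : ℝ → ℝ} {K : ℝ}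
    (hd : ∀ᶠ v in 𝓝[>] 0, HasDerivAt y (y' v) v) (h0 : Tendsto y (𝓝[>] 0) (𝓝 0))
    (hK : ∀ᶠ v in 𝓝[>] 0, y' v ≤ K) : ∀ᶠ v in 𝓝[>] (0 : ℝ), y v ≤ K * v := by
  obtain ⟨δ, hδ, hsub⟩ := mem_nhdsGT_iff_exists_Ioo_subset.1 (hd.and hK)
  have hd' : ∀ v ∈ Ioo 0 δ, HasDerivAt (fun x => y x - K * x) (y' v - K) v := fun v hv => by
    exact ((hsub hv).1.sub ((hasDerivAt_id v).const_mul K)).congr_deriv (by ring)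
  have hanti : AntitoneOn (fun x => y x - K * x) (Ioo 0 δ) := by
    refine antitoneOn_of_deriv_nonpos (convex_Ioo 0 δ)
      (fun v hv => (hd' v hv).continuousAt.continuousWithinAt)
      (fun v hv => (hd' v (interior_subset hv)).differentiableAt.differentiableWithinAt)
      (fun v hv => ?_)
    rw [(hd' v (interior_subset hv)).deriv]
    exact sub_nonpos.2 (hsub (interior_subset hv)).2
  have hlim : Tendsto (fun x => y x - K * x) (𝓝[>] 0) (𝓝 0) := by
    have : Tendsto (fun x : ℝ => K * x) (𝓝[>] 0) (𝓝 0) := by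
      simpa using (tendsto_nhdsWithin_of_tendsto_nhds (tendsto_id (α := ℝ) (x := 𝓝 0))).const_mul K
    simpa using h0.sub this
  filter_upwards [Ioo_mem_nhdsGT hδ] with v hv
  have := ge_of_tendsto hlim (by
    filter_upwards [Ioo_mem_nhdsGT hv.1] with x hx
    exact hanti ⟨hx.1, hx.2.trans hv.2⟩ hv hx.2.le)
  linarith

lemma eventually_mul_le_of_le_hasDerivAt {y y' : ℝ → ℝ} {K : ℝ}
    (hd : ∀ᶠ v in 𝓝[>] 0, HasDerivAt y (y' v) v) (h0 : Tendsto y (𝓝[>] 0) (𝓝 0))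
    (hK : ∀ᶠ v in 𝓝[>] 0, K ≤ y' v) : ∀ᶠ v in 𝓝[>] (0 : ℝ), K * v ≤ y v := by
  have := eventually_le_mul_of_hasDerivAt_le (y := fun v => -y v) (y' := fun v => -y' v)
    (K := -K) (hd.mono fun v hv => hv.neg) (by simpa using h0.neg)
    (hK.mono fun v hv => neg_le_neg hv)
  filter_upwards [this] with v hv
  linarith

/-- The positive solutions on `(0, 1)` of `y' = h(v) - q(v) y ^ (-s)` that vanish at both end
points. -/
structure IsProfile (s : ℝ) (h q y : ℝ → ℝ) : Prop where
  sol : IsPositiveSolutionOn s h q y (Ioo 0 1)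
  tendsto_zero : Tendsto y (𝓝[>] 0) (𝓝 0)
  tendsto_one : Tendsto y (𝓝[<] 1) (𝓝 0)

lemma Ioo_mem_nhdsGT_zero : Ioo (0 : ℝ) 1 ∈ 𝓝[>] (0 : ℝ) := Ioo_mem_nhdsGT one_pos

namespace IsProfile

lemma pos (hy : IsProfile s h q y) {v : ℝ} (hv : v ∈ Ioo (0 : ℝ) 1) : 0 < y v := (hy.sol v hv).1

lemma hasDerivAt (hy : IsProfile s h q y) {v : ℝ} (hv : v ∈ Ioo (0 : ℝ) 1) :
    HasDerivAt y (h v - q v * y v ^ (-s)) v := hy.sol.hasDerivAt isOpen_Ioo hv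

lemma eventually_hasDerivAt (hy : IsProfile s h q y) :
    ∀ᶠ v in 𝓝[>] 0, HasDerivAt y (h v - q v * y v ^ (-s)) v := by
  filter_upwards [Ioo_mem_nhdsGT_zero] with v hv using hy.hasDerivAt hv

lemma eventually_le_mul (hy : IsProfile s h q y) (hq : ∀ v ∈ Ioo (0 : ℝ) 1, 0 < q v) {H K : ℝ}
    (hh : Tendsto h (𝓝[>] 0) (𝓝 H)) (hHK : H < K) : ∀ᶠ v in 𝓝[>] 0, y v ≤ K * v := by
  refine eventually_le_mul_of_hasDerivAt_le hy.eventually_hasDerivAt hy.tendsto_zero ?_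
  filter_upwards [hh.eventually_lt_const hHK, Ioo_mem_nhdsGT_zero] with v h1 hv
  have := mul_pos (hq v hv) (Real.rpow_pos_of_pos (hy.pos hv) (-s))
  linarith

/-- As `y' < h`, a negative limit of `h` would make `y` negative near `0`. This is the source of the
lower bound on admissible speeds. -/
lemma limit_nonneg (hy : IsProfile s h q y) (hq : ∀ v ∈ Ioo (0 : ℝ) 1, 0 < q v) {H : ℝ}
    (hh : Tendsto h (𝓝[>] 0) (𝓝 H)) : 0 ≤ H := by
  by_contra! hH
  obtain ⟨v, h1, hv⟩ := ((hy.eventually_le_mul hq hh hH).and Ioo_mem_nhdsGT_zero).exists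
  linarith [hy.pos hv]

lemma tendsto_div_zero (hy : IsProfile s h q y) (hq : ∀ v ∈ Ioo (0 : ℝ) 1, 0 < q v)
    (hh : Tendsto h (𝓝[>] 0) (𝓝 0)) : Tendsto (fun v => y v / v) (𝓝[>] 0) (𝓝 0) := by
  refine tendsto_order.2 ⟨fun ε hε => ?_, fun ε hε => ?_⟩
  · filter_upwards [Ioo_mem_nhdsGT_zero] with v hv
    exact hε.trans (div_pos (hy.pos hv) hv.1)
  · filter_upwards [hy.eventually_le_mul hq hh (half_pos hε), Ioo_mem_nhdsGT_zero] with v h1 hv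
    rw [div_lt_iff₀ hv.1]
    nlinarith [hv.1]

/-- Either a profile stays below a barrier `b` near `0`, or its slope at `0` is the limit of the
regular part of the right-hand side. -/
lemma eventually_le_or_tendsto_div (hs : 0 < s) (hy : IsProfile s h q y)
    (hq : ∀ v ∈ Ioo (0 : ℝ) 1, 0 < q v) {H K : ℝ} (hh : Tendsto h (𝓝[>] 0) (𝓝 H))
    {b b' : ℝ → ℝ} (hb : ∀ᶠ v in 𝓝[>] 0, 0 < b v)
    (hb' : ∀ᶠ v in 𝓝[>] 0, HasDerivAt b (b' v) v) (hK : ∀ᶠ v in 𝓝[>] 0, b' v ≤ K) (hKH : K < H)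
    (hqb : Tendsto (fun v => q v * b v ^ (-s)) (𝓝[>] 0) (𝓝 0)) :
    (∀ᶠ v in 𝓝[>] 0, y v ≤ b v) ∨ Tendsto (fun v => y v / v) (𝓝[>] 0) (𝓝 H) := by
  by_cases hle : ∀ᶠ v in 𝓝[>] 0, y v ≤ b v
  · exact Or.inl hle
  right
  have hhq : Tendsto (fun v => h v - q v * b v ^ (-s)) (𝓝[>] 0) (𝓝 H) := by
    simpa using hh.sub hqb
  -- Where `y = b`, the derivative of `y` is `h - q b^(-s)`, which exceeds `K ≥ b'` near `0`: the
  -- barrier is crossed upwards only. Since `y > b` at points arbitrarily close to `0`, `y ≥ b`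
  -- throughout a right neighbourhood.
  have hge : ∀ᶠ v in 𝓝[>] 0, b v ≤ y v := by
    obtain ⟨δ, hδ, hsub⟩ := mem_nhdsGT_iff_exists_Ioo_subset.1
      (hb'.and (hK.and ((hhq.eventually_const_lt hKH).and Ioo_mem_nhdsGT_zero)))
    filter_upwards [Ioo_mem_nhdsGT hδ] with v hv
    have hlt : ∃ᶠ x in 𝓝[>] 0, b x < y x := by simpa only [not_le] using not_eventually.1 hle
    obtain ⟨x, hx, hxv⟩ := (hlt.and_eventually (Ioo_mem_nhdsGT hv.1)).exists
    have hI : Icc x v ⊆ Ioo 0 δ := fun t ht => ⟨hxv.1.trans_le ht.1, ht.2.trans_lt hv.2⟩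
    have := nonpos_of_hasDerivAt_neg_of_eq_zero (φ := fun t => b t - y t)
      (φ' := fun t => b' t - (h t - q t * y t ^ (-s))) (a := x) (b := v)
      (fun t ht => (hsub (hI ht)).1.sub (hy.hasDerivAt (hsub (hI ht)).2.2.2)) (by linarith)
      (fun t ht he => by
        obtain ⟨-, h1, h2, -⟩ := hsub (hI (Ico_subset_Icc_self ht))
        rw [← sub_eq_zero.1 he]
        linarith) v (right_mem_Icc.2 hxv.2.le)
    linarith
  -- Above the barrier `q y^(-s) ≤ q b^(-s) → 0`, so `y'` is eventually above any `L' < H`. The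
  -- upper bound needs only `y' < h`.
  refine tendsto_order.2 ⟨fun L hL => ?_, fun L hL => ?_⟩
  · obtain ⟨L', hL1, hL2⟩ := exists_between hL
    have := eventually_mul_le_of_le_hasDerivAt (K := L') hy.eventually_hasDerivAt
      hy.tendsto_zero (by
        filter_upwards [hge, hb, hhq.eventually_const_lt hL2, Ioo_mem_nhdsGT_zero]
          with v h1 h2 h3 hv
        have h4 : y v ^ (-s) ≤ b v ^ (-s) := Real.rpow_le_rpow_of_nonpos h2 h1 (by linarith)
        have := mul_le_mul_of_nonneg_left h4 (hq v hv).le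
        linarith)
    filter_upwards [this, Ioo_mem_nhdsGT_zero] with v h1 hv
    rw [lt_div_iff₀ hv.1]
    exact (mul_lt_mul_of_pos_right hL1 hv.1).trans_le h1
  · obtain ⟨L', hL1, hL2⟩ := exists_between hL
    filter_upwards [hy.eventually_le_mul hq hh hL1, Ioo_mem_nhdsGT_zero] with v h1 hv
    rw [div_lt_iff₀ hv.1]
    exact h1.trans_lt (mul_lt_mul_of_pos_right hL2 hv.1)

lemma tendsto_mul_rpow_neg (hqs : Tendsto (fun v => q v / v ^ s) (𝓝[>] 0) (𝓝 0)) {ε : ℝ}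
    (hε : 0 < ε) : Tendsto (fun v => q v * (ε * v) ^ (-s)) (𝓝[>] 0) (𝓝 0) := by
  have := hqs.mul_const (ε ^ (-s))
  rw [zero_mul] at this
  refine this.congr' ?_
  filter_upwards [self_mem_nhdsWithin] with v hv
  have hv : (0 : ℝ) < v := hv
  rw [Real.mul_rpow hε.le hv.le, Real.rpow_neg hv.le]
  ring

lemma eventually_le_mul_or_tendsto_div (hs : 0 < s) (hy : IsProfile s h q y)
    (hq : ∀ v ∈ Ioo (0 : ℝ) 1, 0 < q v) {H ε : ℝ} (hh : Tendsto h (𝓝[>] 0) (𝓝 H))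
    (hqs : Tendsto (fun v => q v / v ^ s) (𝓝[>] 0) (𝓝 0)) (hε : 0 < ε) (hεH : ε < H) :
    (∀ᶠ v in 𝓝[>] 0, y v ≤ ε * v) ∨ Tendsto (fun v => y v / v) (𝓝[>] 0) (𝓝 H) := by
  refine hy.eventually_le_or_tendsto_div hs hq hh (b' := fun _ => ε) ?_ ?_
    (Eventually.of_forall fun v => le_rfl) hεH (tendsto_mul_rpow_neg hqs hε)
  · filter_upwards [self_mem_nhdsWithin] with v hv using mul_pos hε hv
  · exact Eventually.of_forall fun v => by simpa using (hasDerivAt_id v).const_mul ε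

/-- The slope at `0` of a profile is not maximal if there is a profile for a smaller right-hand
side. -/
lemma not_tendsto_div (hs : 0 < s) (hy : IsProfile s h q y) (hz : IsProfile s k q z)
    (hq : ∀ v ∈ Ioo (0 : ℝ) 1, 0 < q v) {H K : ℝ}
    (hk : Tendsto k (𝓝[>] 0) (𝓝 K)) (hKH : K < H)
    (hc : ContinuousOn (fun v => h v - k v) (Icc 0 1))
    (hpos : ∀ v ∈ Ioc (0 : ℝ) 1, 0 < ∫ t in (0 : ℝ)..v, (h t - k t)) :
    ¬ Tendsto (fun v => y v / v) (𝓝[>] 0) (𝓝 H) := by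
  intro hlim
  obtain ⟨L, hL1, hL2⟩ := exists_between hKH
  set G : ℝ → ℝ := fun v => ∫ t in (0 : ℝ)..v, (h t - k t) with hG
  have hGd : ∀ v ∈ Ioo (0 : ℝ) 1, HasDerivAt G (h v - k v) v := fun v hv =>
    intervalIntegral.integral_hasDerivAt_right
      ((hc.mono (by rw [uIcc_of_le hv.1.le]; exact Icc_subset_Icc_right hv.2.le)).intervalIntegrable)
      ((hc.mono Ioo_subset_Icc_self).stronglyMeasurableAtFilter isOpen_Ioo v hv)
      (hc.continuousAt (Icc_mem_nhds hv.1 hv.2))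
  have hint : IntervalIntegrable (fun t => h t - k t) volume 0 1 :=
    ContinuousOn.intervalIntegrable (by rwa [uIcc_of_le zero_le_one])
  have hGc : ContinuousOn G (Icc 0 1) := by
    have := intervalIntegral.continuousOn_primitive_interval' hint left_mem_uIcc
    rwa [uIcc_of_le zero_le_one] at this
  have hG0 : Tendsto G (𝓝[>] 0) (𝓝 0) := by
    have := (hGc 0 (left_mem_Icc.2 zero_le_one)).tendsto
    rw [show G 0 = 0 by simp [hG]] at this
    exact this.mono_left (nhdsWithin_le_of_mem (mem_of_superset Ioo_mem_nhdsGT_zero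
      Ioo_subset_Icc_self))
  have hG1 : Tendsto G (𝓝[<] 1) (𝓝 (G 1)) :=
    (hGc 1 (right_mem_Icc.2 zero_le_one)).tendsto.mono_left (nhdsWithin_le_of_mem
      (mem_of_superset (Ioo_mem_nhdsLT one_pos) Ioo_subset_Icc_self))
  -- `φ' = q (y^(-s) - z^(-s))` is nonpositive where `y ≥ z`, so `φ ≤ 0` near `0`. At a zero of `φ`
  -- one has `y - z = G > 0`, hence `φ' < 0`, and `φ ≤ 0` persists up to `1`; there it reads `G 1 ≤
  -- 0`.
  set φ : ℝ → ℝ := fun v => G v - (y v - z v) with hφ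
  have hφd : ∀ v ∈ Ioo (0 : ℝ) 1, HasDerivAt φ (q v * (y v ^ (-s) - z v ^ (-s))) v := fun v hv =>
    ((hGd v hv).sub ((hy.hasDerivAt hv).sub (hz.hasDerivAt hv))).congr_deriv (by ring)
  have hzy : ∀ᶠ v in 𝓝[>] 0, z v ≤ y v := by
    filter_upwards [hlim.eventually_const_lt hL2, hz.eventually_le_mul hq hk hL1,
      Ioo_mem_nhdsGT_zero] with v h1 h2 hv
    rw [lt_div_iff₀ hv.1] at h1
    linarith
  have hφ0 : ∀ᶠ v in 𝓝[>] 0, φ v ≤ 0 := by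
    have := eventually_le_mul_of_hasDerivAt_le (y := φ) (K := 0)
      (by filter_upwards [Ioo_mem_nhdsGT_zero] with v hv using hφd v hv)
      (by simpa using hG0.sub (hy.tendsto_zero.sub hz.tendsto_zero))
      (by
        filter_upwards [hzy, Ioo_mem_nhdsGT_zero] with v h1 hv
        have : y v ^ (-s) ≤ z v ^ (-s) :=
          Real.rpow_le_rpow_of_nonpos (hz.pos hv) h1 (by linarith)
        exact mul_nonpos_of_nonneg_of_nonpos (hq v hv).le (sub_nonpos.2 this))
    simpa using this
  obtain ⟨v, hv0, hv⟩ := (hφ0.and Ioo_mem_nhdsGT_zero).exists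
  have hφle : ∀ x ∈ Ico v 1, φ x ≤ 0 := by
    intro x hx
    have hI : Icc v x ⊆ Ioo 0 1 := fun t ht => ⟨hv.1.trans_le ht.1, ht.2.trans_lt hx.2⟩
    refine nonpos_of_hasDerivAt_neg_of_eq_zero (fun t ht => hφd t (hI ht)) hv0
      (fun t ht he => ?_) x (right_mem_Icc.2 hx.1)
    have ht' := hI (Ico_subset_Icc_self ht)
    have h1 : 0 < G t := hpos t ⟨ht'.1, ht'.2.le⟩
    have h2 : z t < y t := by
      simp only [hφ] at he
      linarith
    exact mul_neg_of_pos_of_neg (hq t ht')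
      (sub_neg.2 (Real.rpow_lt_rpow_of_neg (hz.pos ht') h2 (by linarith)))
  have hφ1 : Tendsto φ (𝓝[<] 1) (𝓝 (G 1)) := by
    simpa using hG1.sub (hy.tendsto_one.sub hz.tendsto_one)
  have := le_of_tendsto hφ1 (by
    filter_upwards [Ioo_mem_nhdsLT hv.2] with x hx using hφle x ⟨hx.1.le, hx.2⟩)
  exact absurd (hpos 1 ⟨one_pos, le_rfl⟩) (not_lt.2 this)

/-- A profile whose slope at `0` is not maximal survives small perturbations of the right-hand
side. -/
lemma exists_perturbation (hs : 0 < s) (hy : IsProfile s h q y)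
    (hqc : ContinuousOn q (Ioo 0 1)) (hq : ∀ v ∈ Ioo (0 : ℝ) 1, 0 < q v) {H : ℝ}
    (hh : Tendsto h (𝓝[>] 0) (𝓝 H)) (hH : 0 < H)
    (hqs : Tendsto (fun v => q v / v ^ s) (𝓝[>] 0) (𝓝 0))
    (hlim : ¬ Tendsto (fun v => y v / v) (𝓝[>] 0) (𝓝 H)) :
    ∃ η, 0 < η ∧ ∀ k : ℝ → ℝ, ContinuousOn k (Ioo 0 1) →
      (∀ v ∈ Ioo (0 : ℝ) 1, |k v - h v| ≤ η) → ∃ z, IsProfile s k q z := by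
  have hle := (hy.eventually_le_mul_or_tendsto_div hs hq hh hqs (half_pos hH)
    (half_lt_self hH)).resolve_right hlim
  have hε : 0 < 3 / 4 * H := by positivity
  have hhq : Tendsto (fun v => h v - q v * (3 / 4 * H * v) ^ (-s)) (𝓝[>] 0) (𝓝 H) := by
    simpa using hh.sub (tendsto_mul_rpow_neg hqs hε)
  obtain ⟨δ, hδ, hsub⟩ := mem_nhdsGT_iff_exists_Ioo_subset.1
    ((hhq.eventually_const_lt (show 7 / 8 * H < H by linarith)).and (hle.and Ioo_mem_nhdsGT_zero))
  have hδ : 0 < δ := hδ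
  set v := δ / 2 with hv
  have hvδ : v ∈ Ioo 0 δ := ⟨by positivity, by linarith⟩
  -- The barrier is the line of slope `3/4 * H`. The bound `H / 4 * v` keeps `z v` below it, given
  -- `y v ≤ H / 2 * v`. The bound `H / 16` leaves `7/8 - 1/16 - 3/4 = 1/16 > 0`, so above the line
  -- `z` grows faster than the line.
  refine ⟨min (H / 16) (H / 4 * v), lt_min (by positivity) (mul_pos (by positivity) hvδ.1),
    fun k hk hkh => ?_⟩
  have hη0 : 0 ≤ min (H / 16) (H / 4 * v) :=
    le_min (by positivity) (mul_nonneg (by positivity) hvδ.1.le)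
  obtain ⟨z, hz, hzy⟩ := hy.sol.exists_perturbation hs hk hqc hq hη0 hkh
  have hzv : z v ≤ 3 / 4 * H * v := by
    have h1 := (abs_le.1 (hzy v (hsub hvδ).2.2)).2
    have h2 : min (H / 16) (H / 4 * v) * (1 - v) ≤ min (H / 16) (H / 4 * v) :=
      mul_le_of_le_one_right hη0 (by linarith [hvδ.1])
    have h3 := min_le_right (H / 16) (H / 4 * v)
    have h4 : y v ≤ H / 2 * v := (hsub hvδ).2.1
    linarith
  -- Were `z` above the line at `x`, the excess could not decrease between `x` and `v`, yet it is
  -- nonpositive at `v`.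
  have hzle : ∀ x ∈ Ioo 0 v, z x ≤ 3 / 4 * H * x := by
    intro x hx
    by_contra! hlt
    have hI : Icc x v ⊆ Ioo 0 δ := fun t ht => ⟨hx.1.trans_le ht.1, ht.2.trans_lt hvδ.2⟩
    have hd : ∀ t ∈ Icc x v, HasDerivAt (fun t => z t - 3 / 4 * H * t)
        (k t - q t * z t ^ (-s) - 3 / 4 * H) t := fun t ht =>
      ((hz.hasDerivAt isOpen_Ioo (hsub (hI ht)).2.2).sub
        ((hasDerivAt_id t).const_mul (3 / 4 * H))).congr_deriv (by ring)
    have key := le_of_hasDerivWithinAt_nonneg_of_pos hx.2.le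
      (fun t ht => (hd t ht).continuousAt.continuousWithinAt)
      (fun t ht => (hd t (Ico_subset_Icc_self ht)).hasDerivWithinAt) (by linarith)
      (fun t ht hpos => by
        obtain ⟨h1, -, h3⟩ := hsub (hI (Ico_subset_Icc_self ht))
        have h4 := (abs_le.1 (hkh t h3)).1
        have h5 := min_le_left (H / 16) (H / 4 * v)
        have h6 : z t ^ (-s) ≤ (3 / 4 * H * t) ^ (-s) :=
          Real.rpow_le_rpow_of_nonpos (mul_pos hε h3.1) (by linarith) (by linarith)
        have h7 := mul_le_mul_of_nonneg_left h6 (hq t h3).le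
        linarith)
    linarith
  refine ⟨z, hz, ?_, ?_⟩
  · have hlin : Tendsto (fun x : ℝ => 3 / 4 * H * x) (𝓝[>] 0) (𝓝 0) := by
      simpa using (tendsto_nhdsWithin_of_tendsto_nhds
        (tendsto_id (α := ℝ) (x := 𝓝 0))).const_mul (3 / 4 * H)
    refine tendsto_of_tendsto_of_tendsto_of_le_of_le' tendsto_const_nhds hlin ?_ ?_
    · filter_upwards [Ioo_mem_nhdsGT_zero] with x hx using (hz x hx).1.le
    · filter_upwards [Ioo_mem_nhdsGT hvδ.1] with x hx using hzle x hx
  · have h1 : Tendsto (fun x : ℝ => min (H / 16) (H / 4 * v) * (1 - x)) (𝓝[<] 1) (𝓝 0) := by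
      have : ContinuousAt (fun x : ℝ => min (H / 16) (H / 4 * v) * (1 - x)) 1 := by fun_prop
      simpa using this.tendsto.mono_left nhdsWithin_le_nhds
    have h2 : Tendsto (fun x => z x - y x) (𝓝[<] 1) (𝓝 0) := by
      refine squeeze_zero_norm' ?_ h1
      filter_upwards [Ioo_mem_nhdsLT one_pos] with x hx using hzy x hx
    simpa using h2.add hy.tendsto_one

end IsProfile

end SingularEquation

/-! ### Intervals with extended real end points -/

section Intervals
variable {α β : EReal}

lemma isOpen_openInterval : IsOpen (openInterval α β) :=
  (isOpen_Ioo (a := α) (b := β)).preimage continuous_coe_real_ereal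

lemma ordConnected_openInterval : (openInterval α β).OrdConnected :=
  ⟨fun _ hx _ hy _ hz => ⟨hx.1.trans_le (EReal.coe_le_coe_iff.2 hz.1),
    (EReal.coe_le_coe_iff.2 hz.2).trans_lt hy.2⟩⟩

lemma leftLimit_hasBasis (h : α < β) : (leftLimit β).HasBasis (fun x : ℝ => x ∈ openInterval α β)
    (fun x => {t | x < t ∧ (t : EReal) < β}) := by
  refine ((nhdsLT_basis_of_exists_lt ⟨α, h⟩).comap _).to_hasBasis (fun x hx => ?_)
    (fun x hx => ⟨x, hx.2, fun t ht => ⟨EReal.coe_lt_coe_iff.1 ht.1, ht.2⟩⟩)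
  obtain ⟨t, h1, h2⟩ := EReal.lt_iff_exists_real_btwn.1 (max_lt hx h)
  exact ⟨t, ⟨(le_max_right _ _).trans_lt h1, h2⟩, fun r hr =>
    ⟨((le_max_left _ _).trans_lt h1).trans (EReal.coe_lt_coe_iff.2 hr.1), hr.2⟩⟩

lemma rightLimit_hasBasis (h : α < β) : (rightLimit α).HasBasis (fun x : ℝ => x ∈ openInterval α β)
    (fun x => {t | α < (t : EReal) ∧ t < x}) := by
  refine ((nhdsGT_basis_of_exists_gt ⟨β, h⟩).comap _).to_hasBasis (fun x hx => ?_)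
    (fun x hx => ⟨x, hx.1, fun t ht => ⟨ht.1, EReal.coe_lt_coe_iff.1 ht.2⟩⟩)
  obtain ⟨t, h1, h2⟩ := EReal.lt_iff_exists_real_btwn.1 (lt_min hx h)
  exact ⟨t, ⟨h1, h2.trans_le (min_le_right _ _)⟩, fun r hr =>
    ⟨hr.1, (EReal.coe_lt_coe_iff.2 hr.2).trans (h2.trans_le (min_le_left _ _))⟩⟩

lemma leftLimit_neBot (h : α < β) : (leftLimit β).NeBot := by
  refine (leftLimit_hasBasis h).neBot_iff.2 fun {x} hx => ?_
  obtain ⟨t, h1, h2⟩ := EReal.lt_iff_exists_real_btwn.1 hx.2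
  exact ⟨t, EReal.coe_lt_coe_iff.1 h1, h2⟩

lemma rightLimit_neBot (h : α < β) : (rightLimit α).NeBot := by
  refine (rightLimit_hasBasis h).neBot_iff.2 fun {x} hx => ?_
  obtain ⟨t, h1, h2⟩ := EReal.lt_iff_exists_real_btwn.1 hx.1
  exact ⟨t, h1, EReal.coe_lt_coe_iff.1 h2⟩

lemma eventually_mem_leftLimit {x : ℝ} (hx : x ∈ openInterval α β) :
    ∀ᶠ t in leftLimit β, t ∈ openInterval α β ∧ x < t :=
  mem_of_superset ((leftLimit_hasBasis (hx.1.trans hx.2)).mem_of_mem hx) fun _ ht =>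
    ⟨⟨hx.1.trans (EReal.coe_lt_coe_iff.2 ht.1), ht.2⟩, ht.1⟩

lemma eventually_mem_rightLimit {x : ℝ} (hx : x ∈ openInterval α β) :
    ∀ᶠ t in rightLimit α, t ∈ openInterval α β ∧ t < x :=
  mem_of_superset ((rightLimit_hasBasis (hx.1.trans hx.2)).mem_of_mem hx) fun _ ht =>
    ⟨⟨ht.1, (EReal.coe_lt_coe_iff.2 ht.2).trans hx.2⟩, ht.2⟩

lemma nonempty_openInterval (h : α < β) : (openInterval α β).Nonempty := by
  obtain ⟨t, h1, h2⟩ := EReal.lt_iff_exists_real_btwn.1 h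
  exact ⟨t, h1, h2⟩

end Intervals

lemma nonneg_of_hasDerivAt_of_forall_le {φ : ℝ → ℝ} {φ' a b : ℝ} (hab : a < b)
    (hd : HasDerivAt φ φ' b) (h : ∀ t ∈ Ioo a b, φ t ≤ φ b) : 0 ≤ φ' := by
  have hlim := (hasDerivWithinAt_iff_tendsto_slope' (by simp)).1 (hd.hasDerivWithinAt (s := Iio b))
  refine ge_of_tendsto hlim ?_
  filter_upwards [Ioo_mem_nhdsLT hab] with t ht
  rw [slope_def_field]
  exact div_nonneg_of_nonpos (sub_nonpos.2 (h t ht)) (sub_nonpos.2 ht.2.le)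

lemma contDiffOn_one_of_hasDerivAt {I : Set ℝ} (hI : IsOpen I) {u u' : ℝ → ℝ}
    (hd : ∀ t ∈ I, HasDerivAt u (u' t) t) (hc : ContinuousOn u' I) : ContDiffOn ℝ 1 u I := by
  rw [show (1 : WithTop ℕ∞) = 0 + 1 by simp, contDiffOn_succ_iff_deriv_of_isOpen hI]
  refine ⟨fun t ht => (hd t ht).differentiableAt.differentiableWithinAt, by simp, ?_⟩
  rw [contDiffOn_zero]
  exact hc.congr fun t ht => (hd t ht).deriv

/-! ### From waves to profiles -/

section TravelingWaves

variable {p : ℝ} {f g ρ d : ℝ → ℝ} {c : ℝ} {α β : EReal} {u : ℝ → ℝ}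

lemma neg_flux_eq {t : ℝ} (ht : deriv u t < 0) :
    -flux p d u t = d (u t) * (-deriv u t) ^ (p - 1) := by
  rw [flux, abs_of_neg ht, show p - 1 = (p - 2) + 1 by ring,
    Real.rpow_add (neg_pos.2 ht), Real.rpow_one]
  ring

lemma abs_flux_eq (hp : 1 < p) {t : ℝ} (hd : 0 < d (u t)) :
    |flux p d u t| = d (u t) * |deriv u t| ^ (p - 1) := by
  rcases eq_or_ne (deriv u t) 0 with h0 | h0
  · simp [flux, h0, Real.zero_rpow (sub_pos.2 hp).ne']
  · have h1 : 0 < |deriv u t| := abs_pos.2 h0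
    rw [flux, abs_mul, abs_mul, abs_of_pos hd, abs_of_pos (Real.rpow_pos_of_pos h1 _),
      show p - 1 = (p - 2) + 1 by ring, Real.rpow_add h1, Real.rpow_one]
    ring

lemma StructuralHypotheses.one_div_pos (H : StructuralHypotheses p f g ρ d) :
    0 < 1 / (p - 1) := _root_.one_div_pos.2 (sub_pos.2 H.one_lt_p)

lemma rpow_one_div_rpow_sub_one (hp : 1 < p) {x : ℝ} (hx : 0 ≤ x) :
    (x ^ (1 / (p - 1))) ^ (p - 1) = x := by
  rw [← Real.rpow_mul hx, one_div_mul_cancel (sub_pos.2 hp).ne', Real.rpow_one]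

lemma rpow_sub_one_rpow_one_div (hp : 1 < p) {x : ℝ} (hx : 0 ≤ x) :
    (x ^ (p - 1)) ^ (1 / (p - 1)) = x := by
  rw [← Real.rpow_mul hx, mul_one_div_cancel (sub_pos.2 hp).ne', Real.rpow_one]

namespace IsTravelingWave

lemma hasDerivAt (hu : IsTravelingWave p f g ρ d c α β u) {t : ℝ} (ht : t ∈ openInterval α β) :
    HasDerivAt u (deriv u t) t :=
  ((hu.contDiffOn.differentiableOn (by simp)).differentiableAt
    (isOpen_openInterval.mem_nhds ht)).hasDerivAt

lemma hasDerivAt_flux (hu : IsTravelingWave p f g ρ d c α β u) {t : ℝ}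
    (ht : t ∈ openInterval α β) :
    HasDerivAt (flux p d u) (-((c * g (u t) - f (u t)) * deriv u t + ρ (u t))) t := by
  have := ((hu.contDiffOn_flux.differentiableOn (by simp)).differentiableAt
    (isOpen_openInterval.mem_nhds ht)).hasDerivAt
  refine this.congr_deriv ?_
  linarith [hu.equation t ht]

/-- Where the flux vanishes, `u' = 0` and its derivative is `-ρ < 0`, so the flux changes sign only
downwards. If `u' ≥ 0` at `t₀`, the flux is positive before `t₀`, so `u` is nondecreasing there and
cannot tend to `1` at `α` while staying below `1`. -/
lemma deriv_neg (H : StructuralHypotheses p f g ρ d) (hu : IsTravelingWave p f g ρ d c α β u)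
    {t₀ : ℝ} (ht₀ : t₀ ∈ openInterval α β) : deriv u t₀ < 0 := by
  by_contra! h0
  have hflux0 : 0 ≤ flux p d u t₀ :=
    mul_nonneg (mul_nonneg (H.d_pos _ (hu.mem_Ioo _ ht₀)).le (Real.rpow_nonneg (abs_nonneg _) _)) h0
  have hcrit : ∀ t ∈ openInterval α β, flux p d u t = 0 →
      -((c * g (u t) - f (u t)) * deriv u t + ρ (u t)) < 0 := by
    intro t ht h
    have hd := H.d_pos _ (hu.mem_Ioo _ ht)
    have h1 : |deriv u t| ^ (p - 1) = 0 := by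
      have := abs_flux_eq H.one_lt_p hd
      rw [h, abs_zero, zero_eq_mul] at this
      exact this.resolve_left hd.ne'
    have h2 := abs_eq_zero.1 ((Real.rpow_eq_zero (abs_nonneg _)
      (sub_pos.2 H.one_lt_p).ne').1 h1)
    rw [h2]
    linarith [H.ρ_pos _ (hu.mem_Ioo _ ht)]
  have hpos : ∀ t ∈ openInterval α β, t < t₀ → 0 < flux p d u t := by
    intro t ht htt
    by_contra! hle
    have hI : Icc t t₀ ⊆ openInterval α β := ordConnected_openInterval.out ht ht₀
    have h1 := nonpos_of_hasDerivAt_neg_of_eq_zero (fun x hx => hu.hasDerivAt_flux (hI hx)) hle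
      (fun x hx => hcrit x (hI (Ico_subset_Icc_self hx)))
    have h2 : flux p d u t₀ = 0 := le_antisymm (h1 t₀ (right_mem_Icc.2 htt.le)) hflux0
    have h3 := nonneg_of_hasDerivAt_of_forall_le htt (hu.hasDerivAt_flux ht₀)
      (fun x hx => h2 ▸ h1 x (Ioo_subset_Icc_self hx))
    exact absurd (hcrit t₀ ht₀ h2) (not_lt.2 h3)
  have hmono : ∀ t ∈ openInterval α β, ∀ t' ∈ openInterval α β, t < t' → t' < t₀ → u t ≤ u t' := by
    intro t ht t' ht' htt htt'
    have hI : Icc t t' ⊆ openInterval α β := ordConnected_openInterval.out ht ht'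
    refine monotoneOn_of_deriv_nonneg (convex_Icc t t')
      (fun x hx => (hu.hasDerivAt (hI hx)).continuousAt.continuousWithinAt)
      (fun x hx => (hu.hasDerivAt (hI (interior_subset hx))).differentiableAt.differentiableWithinAt)
      (fun x hx => ?_) (left_mem_Icc.2 htt.le) (right_mem_Icc.2 htt.le) htt.le
    have hx' := interior_subset hx
    by_contra! hneg
    have h1 := hpos x (hI hx') (hx'.2.trans_lt htt')
    have h2 : flux p d u x ≤ 0 := mul_nonpos_of_nonneg_of_nonpos
      (mul_nonneg (H.d_pos _ (hu.mem_Ioo _ (hI hx'))).le (Real.rpow_nonneg (abs_nonneg _) _)) hneg.le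
    linarith
  have := rightLimit_neBot hu.lt
  obtain ⟨t₁, ht₁, h₁⟩ := (eventually_mem_rightLimit ht₀).exists
  have h2 : 1 ≤ u t₁ := le_of_tendsto hu.tendsto_left (by
    filter_upwards [eventually_mem_rightLimit ht₁] with t ht using hmono t ht.1 t₁ ht₁ ht.2 h₁)
  linarith [(hu.mem_Ioo t₁ ht₁).2]

lemma strictAntiOn (H : StructuralHypotheses p f g ρ d)
    (hu : IsTravelingWave p f g ρ d c α β u) : StrictAntiOn u (openInterval α β) :=
  strictAntiOn_of_deriv_neg ordConnected_openInterval.convex hu.contDiffOn.continuousOn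
    (fun _ ht => hu.deriv_neg H (interior_subset ht))

lemma surjOn (hu : IsTravelingWave p f g ρ d c α β u) :
    SurjOn u (openInterval α β) (Ioo 0 1) := by
  intro v hv
  have := rightLimit_neBot hu.lt
  have := leftLimit_neBot hu.lt
  obtain ⟨t, ht⟩ := nonempty_openInterval hu.lt
  obtain ⟨t₁, h1, ht₁, -⟩ := ((hu.tendsto_left.eventually_const_lt hv.2).and
    (eventually_mem_rightLimit ht)).exists
  obtain ⟨t₂, h2, ht₂, -⟩ := ((hu.tendsto_right.eventually_lt_const hv.1).and
    (eventually_mem_leftLimit ht)).exists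
  exact ordConnected_openInterval.isPreconnected.intermediate_value ht₂ ht₁
    hu.contDiffOn.continuousOn ⟨h2.le, h1.le⟩

lemma tendsto_nhdsGT (hu : IsTravelingWave p f g ρ d c α β u) :
    Tendsto u (leftLimit β) (𝓝[>] 0) := by
  obtain ⟨t, ht⟩ := nonempty_openInterval hu.lt
  refine tendsto_nhdsWithin_iff.2 ⟨hu.tendsto_right, ?_⟩
  filter_upwards [eventually_mem_leftLimit ht] with x hx using (hu.mem_Ioo x hx.1).1

/-- In terms of the profile variable `v = u(t)`, the negative of the flux solves a singular
first-order equation. -/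
lemma exists_isProfile (H : StructuralHypotheses p f g ρ d)
    (hu : IsTravelingWave p f g ρ d c α β u) :
    ∃ y, IsProfile (1 / (p - 1)) (fun v => c * g v - f v) (fun v => ρ v * d v ^ (1 / (p - 1))) y ∧
      ∀ t ∈ openInterval α β, deriv u t = -((y (u t) / d (u t)) ^ (1 / (p - 1))) := by
  set I := openInterval α β
  set τ := Function.invFunOn u I
  have hτ : ∀ v ∈ Ioo (0 : ℝ) 1, τ v ∈ I := fun v hv => Function.invFunOn_mem (hu.surjOn hv)
  have huτ : ∀ v ∈ Ioo (0 : ℝ) 1, u (τ v) = v := fun v hv => Function.invFunOn_eq (hu.surjOn hv)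
  have hτu : ∀ t ∈ I, τ (u t) = t := fun t ht => (hu.strictAntiOn H).injOn.leftInvOn_invFunOn ht
  have hderiv : ∀ t ∈ I,
      deriv u t = -((-flux p d u t / d (u t)) ^ (1 / (p - 1))) := by
    intro t ht
    have h0 := hu.deriv_neg H ht
    rw [neg_flux_eq h0, mul_div_cancel_left₀ _ (H.d_pos _ (hu.mem_Ioo t ht)).ne',
      rpow_sub_one_rpow_one_div H.one_lt_p (neg_pos.2 h0).le, neg_neg]
  refine ⟨fun v => -flux p d u (τ v), ⟨fun v hv => ?_, ?_, ?_⟩, fun t ht => ?_⟩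
  · obtain ⟨t, ht, rfl⟩ := hu.surjOn hv
    have h0 := hu.deriv_neg H ht
    have hd := H.d_pos _ hv
    have h1 := neg_flux_eq (p := p) (d := d) h0
    have hτd : HasDerivAt τ (deriv u t)⁻¹ (u t) := by
      refine (HasStrictDerivAt.to_local_left_inverse ?_ h0.ne ?_).hasDerivAt
      · exact (hu.contDiffOn.contDiffAt (isOpen_openInterval.mem_nhds ht)).hasStrictDerivAt (by simp)
      · filter_upwards [isOpen_openInterval.mem_nhds ht] with x hx using hτu x hx
    have hfl : HasDerivAt (flux p d u) (-((c * g (u t) - f (u t)) * deriv u t + ρ (u t)))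
        (τ (u t)) := by
      rw [hτu t ht]
      exact hu.hasDerivAt_flux ht
    have hu0 : 0 < -deriv u t := neg_pos.2 h0
    simp only [hτu t ht]
    refine ⟨by rw [h1]; positivity,
      ((hfl.comp (u t) hτd).neg.congr_deriv ?_).hasDerivWithinAt⟩
    -- From `y = d (-u')^(p-1)` one gets `y^s = d^s (-u')`, so the term `ρ / u'` equals `-ρ d^s
    -- y^(-s)`.
    rw [h1, Real.rpow_neg (by positivity), Real.mul_rpow hd.le (by positivity),
      rpow_sub_one_rpow_one_div H.one_lt_p hu0.le]
    have hds : d (u t) ^ (1 / (p - 1)) ≠ 0 := (Real.rpow_pos_of_pos hd _).ne'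
    have h0' := h0.ne
    field_simp
    ring
  · have hlim : Tendsto τ (𝓝[>] 0) (leftLimit β) := by
      refine (leftLimit_hasBasis hu.lt).tendsto_right_iff.2 fun x hx => ?_
      have hux := hu.mem_Ioo x hx
      filter_upwards [Ioo_mem_nhdsGT hux.1] with v hv
      have hv' : v ∈ Ioo (0 : ℝ) 1 := ⟨hv.1, hv.2.trans hux.2⟩
      exact ⟨((hu.strictAntiOn H).lt_iff_gt (hτ v hv') hx).1 (by rw [huτ v hv']; exact hv.2),
        (hτ v hv').2⟩
    simpa using (hu.flux_right.comp hlim).neg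
  · have hlim : Tendsto τ (𝓝[<] 1) (rightLimit α) := by
      refine (rightLimit_hasBasis hu.lt).tendsto_right_iff.2 fun x hx => ?_
      have hux := hu.mem_Ioo x hx
      filter_upwards [Ioo_mem_nhdsLT hux.2] with v hv
      have hv' : v ∈ Ioo (0 : ℝ) 1 := ⟨hux.1.trans hv.1, hv.2⟩
      exact ⟨(hτ v hv').1,
        ((hu.strictAntiOn H).lt_iff_gt hx (hτ v hv')).1 (by rw [huτ v hv']; exact hv.1)⟩
    simpa using (hu.flux_left.comp hlim).neg
  · simp only [hτu t ht]
    exact hderiv t ht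

end IsTravelingWave

/-! ### From profiles to waves -/

/-- The image of a strictly decreasing continuous function on `(0, 1)` is an open interval. -/
lemma exists_image_eq_openInterval {T : ℝ → ℝ} (hT : StrictAntiOn T (Ioo 0 1))
    (hc : ContinuousOn T (Ioo 0 1)) :
    ∃ α β : EReal, α < β ∧ T '' Ioo 0 1 = openInterval α β := by
  have hmid : (1 / 2 : ℝ) ∈ Ioo (0 : ℝ) 1 := by norm_num
  have hsub : ∀ v ∈ Ioo (0 : ℝ) 1, (⨅ w ∈ Ioo (0 : ℝ) 1, (T w : EReal)) < T v ∧
      (T v : EReal) < ⨆ w ∈ Ioo (0 : ℝ) 1, (T w : EReal) := by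
    intro v hv
    obtain ⟨w, hw⟩ := exists_between hv.2
    obtain ⟨w', hw'⟩ := exists_between hv.1
    have h1 : w ∈ Ioo (0 : ℝ) 1 := ⟨hv.1.trans hw.1, hw.2⟩
    have h2 : w' ∈ Ioo (0 : ℝ) 1 := ⟨hw'.1, hw'.2.trans hv.2⟩
    exact ⟨(iInf₂_le w h1).trans_lt (EReal.coe_lt_coe_iff.2 (hT hv h1 hw.1)),
      (EReal.coe_lt_coe_iff.2 (hT h2 hv hw'.2)).trans_le
        (le_iSup₂ (f := fun w (_ : w ∈ Ioo (0 : ℝ) 1) => (T w : EReal)) w' h2)⟩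
  refine ⟨⨅ w ∈ Ioo (0 : ℝ) 1, (T w : EReal), ⨆ w ∈ Ioo (0 : ℝ) 1, (T w : EReal),
    (hsub _ hmid).1.trans (hsub _ hmid).2, Subset.antisymm ?_ fun t ht => ?_⟩
  · rintro _ ⟨v, hv, rfl⟩
    exact hsub v hv
  · obtain ⟨h1, h2⟩ := ht
    simp only [iInf_lt_iff, lt_iSup_iff, EReal.coe_lt_coe_iff] at h1 h2
    obtain ⟨v₁, hv₁, h1⟩ := h1
    obtain ⟨v₂, hv₂, h2⟩ := h2
    exact isPreconnected_Ioo.intermediate_value hv₁ hv₂ hc ⟨h1.le, h2.le⟩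

lemma exists_primitive_of_continuousOn {r : ℝ → ℝ} (hr : ContinuousOn r (Ioo 0 1)) :
    ∃ T : ℝ → ℝ, ∀ v ∈ Ioo (0 : ℝ) 1, HasStrictDerivAt T (r v) v := by
  refine ⟨fun v => ∫ x in (1 / 2 : ℝ)..v, r x, fun v hv => ?_⟩
  have hmid : (1 / 2 : ℝ) ∈ Ioo (0 : ℝ) 1 := by norm_num
  exact intervalIntegral.integral_hasStrictDerivAt_right
    ((hr.mono (ordConnected_Ioo.uIcc_subset hmid hv)).intervalIntegrable)
    (hr.stronglyMeasurableAtFilter isOpen_Ioo v hv) (hr.continuousAt (isOpen_Ioo.mem_nhds hv))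

/-- The separable equation `u' = -r(u)` has a solution decreasing from `1` to `0`. -/
lemma exists_separable_solution {r : ℝ → ℝ} (hr : ContinuousOn r (Ioo 0 1))
    (hpos : ∀ v ∈ Ioo (0 : ℝ) 1, 0 < r v) :
    ∃ (α β : EReal) (u : ℝ → ℝ), α < β ∧ (∀ t ∈ openInterval α β, u t ∈ Ioo (0 : ℝ) 1) ∧
      (∀ t ∈ openInterval α β, HasDerivAt u (-r (u t)) t) ∧
      Tendsto u (rightLimit α) (𝓝[<] 1) ∧ Tendsto u (leftLimit β) (𝓝[>] 0) := by
  -- Separation of variables: `u` is the inverse of a primitive `T` of `-1/r`, and its interval of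
  -- definition is the range of `T`.
  obtain ⟨T, hTd⟩ := exists_primitive_of_continuousOn (r := fun v => -(r v)⁻¹)
    ((hr.inv₀ fun v hv => (hpos v hv).ne').neg)
  have hTneg : ∀ v ∈ Ioo (0 : ℝ) 1, -(r v)⁻¹ < 0 := fun v hv => by
    have := inv_pos.2 (hpos v hv)
    linarith
  have hTc : ContinuousOn T (Ioo 0 1) := fun v hv =>
    (hTd v hv).hasDerivAt.continuousAt.continuousWithinAt
  have hTanti : StrictAntiOn T (Ioo 0 1) :=
    strictAntiOn_of_deriv_neg (convex_Ioo 0 1) hTc fun v hv => by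
      rw [(hTd v (interior_subset hv)).hasDerivAt.deriv]
      exact hTneg v (interior_subset hv)
  obtain ⟨α, β, hαβ, hIm⟩ := exists_image_eq_openInterval hTanti hTc
  set u := Function.invFunOn T (Ioo 0 1)
  have huT : ∀ v ∈ Ioo (0 : ℝ) 1, u (T v) = v := fun v hv =>
    hTanti.injOn.leftInvOn_invFunOn hv
  have hTmem : ∀ v ∈ Ioo (0 : ℝ) 1, T v ∈ openInterval α β := fun v hv =>
    hIm ▸ mem_image_of_mem T hv
  have hex : ∀ t ∈ openInterval α β, ∃ v ∈ Ioo (0 : ℝ) 1, T v = t := fun t ht => by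
    rwa [← hIm] at ht
  refine ⟨α, β, u, hαβ, fun t ht => ?_, fun t ht => ?_, ?_, ?_⟩
  · obtain ⟨v, hv, rfl⟩ := hex t ht
    rwa [huT v hv]
  · obtain ⟨v, hv, rfl⟩ := hex t ht
    rw [huT v hv]
    have := (hTd v hv).to_local_left_inverse (hTneg v hv).ne (g := u)
      (by filter_upwards [isOpen_Ioo.mem_nhds hv] with x hx using huT x hx)
    exact this.hasDerivAt.congr_deriv (by rw [inv_neg, inv_inv])
  · refine (nhdsLT_basis_of_exists_lt ⟨(0 : ℝ), one_pos⟩).tendsto_right_iff.2 fun w hw => ?_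
    obtain ⟨v, hv1, hv2⟩ := exists_between (max_lt hw one_pos)
    have hv : v ∈ Ioo (0 : ℝ) 1 := ⟨(le_max_right _ _).trans_lt hv1, hv2⟩
    filter_upwards [eventually_mem_rightLimit (hTmem v hv)] with t ht
    obtain ⟨x, hx, rfl⟩ := hex t ht.1
    rw [huT x hx]
    exact ⟨((le_max_left _ _).trans_lt hv1).trans ((hTanti.lt_iff_gt hx hv).1 ht.2), hx.2⟩
  · refine (nhdsGT_basis_of_exists_gt ⟨(1 : ℝ), one_pos⟩).tendsto_right_iff.2 fun w hw => ?_
    obtain ⟨v, hv1, hv2⟩ := exists_between (lt_min hw one_pos)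
    have hv : v ∈ Ioo (0 : ℝ) 1 := ⟨hv1, hv2.trans_le (min_le_right _ _)⟩
    filter_upwards [eventually_mem_leftLimit (hTmem v hv)] with t ht
    obtain ⟨x, hx, rfl⟩ := hex t ht.1
    rw [huT x hx]
    exact ⟨hx.1, ((hTanti.lt_iff_gt hv hx).1 ht.2).trans (hv2.trans_le (min_le_left _ _))⟩

lemma StructuralHypotheses.continuousOn_weight (H : StructuralHypotheses p f g ρ d) :
    ContinuousOn (fun v => ρ v * d v ^ (1 / (p - 1))) (Ioo 0 1) :=
  (H.continuousOn_ρ.mono Ioo_subset_Icc_self).mul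
    (H.contDiffOn_d.continuousOn.rpow_const fun v hv => Or.inl (H.d_pos v hv).ne')

lemma StructuralHypotheses.weight_pos (H : StructuralHypotheses p f g ρ d) :
    ∀ v ∈ Ioo (0 : ℝ) 1, 0 < ρ v * d v ^ (1 / (p - 1)) := fun v hv =>
  mul_pos (H.ρ_pos v hv) (Real.rpow_pos_of_pos (H.d_pos v hv) _)

lemma StructuralHypotheses.continuousOn_drift (H : StructuralHypotheses p f g ρ d) (c : ℝ) :
    ContinuousOn (fun v => c * g v - f v) (Icc 0 1) :=
  (H.continuousOn_g.const_smul c).sub H.continuousOn_f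

/-- Solving `u' = -(y(u)/d(u))^(1/(p-1))` makes the flux equal to `-y(u)`. The chain rule then turns
the profile equation into the wave equation. -/
lemma IsProfile.exists_isTravelingWave (H : StructuralHypotheses p f g ρ d) {y : ℝ → ℝ}
    (hy : IsProfile (1 / (p - 1)) (fun v => c * g v - f v)
      (fun v => ρ v * d v ^ (1 / (p - 1))) y) : c ∈ admissibleSpeeds p f g ρ d := by
  have hyc : ContinuousOn y (Ioo 0 1) := hy.sol.continuousOn
  have hdc := H.contDiffOn_d.continuousOn
  have hrc : ContinuousOn (fun v => (y v / d v) ^ (1 / (p - 1))) (Ioo 0 1) :=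
    (hyc.div hdc fun v hv => (H.d_pos v hv).ne').rpow_const fun v hv =>
      Or.inl (div_pos (hy.pos hv) (H.d_pos v hv)).ne'
  have hrpos : ∀ v ∈ Ioo (0 : ℝ) 1, 0 < (y v / d v) ^ (1 / (p - 1)) := fun v hv =>
    Real.rpow_pos_of_pos (div_pos (hy.pos hv) (H.d_pos v hv)) _
  obtain ⟨α, β, u, hαβ, hu01, hud, huα, huβ⟩ := exists_separable_solution hrc hrpos
  have huc : ContinuousOn u (openInterval α β) := fun t ht =>
    (hud t ht).continuousAt.continuousWithinAt
  have hfl : ∀ t ∈ openInterval α β, flux p d u t = -y (u t) := by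
    intro t ht
    have hd := H.d_pos _ (hu01 t ht)
    have h0 : deriv u t = -(y (u t) / d (u t)) ^ (1 / (p - 1)) := (hud t ht).deriv
    have h1 := neg_flux_eq (p := p) (d := d) (u := u) (t := t)
      (by rw [h0]; exact neg_neg_of_pos (hrpos _ (hu01 t ht)))
    rw [h0, neg_neg, rpow_one_div_rpow_sub_one H.one_lt_p
      (div_pos (hy.pos (hu01 t ht)) hd).le, mul_div_cancel₀ _ hd.ne'] at h1
    linarith
  have hfld : ∀ t ∈ openInterval α β, HasDerivAt (flux p d u)
      (-(((c * g (u t) - f (u t)) - ρ (u t) * d (u t) ^ (1 / (p - 1)) * y (u t) ^ (-(1 / (p - 1)))) *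
        -(y (u t) / d (u t)) ^ (1 / (p - 1)))) t := by
    intro t ht
    refine (((hy.hasDerivAt (hu01 t ht)).comp t (hud t ht)).neg).congr_of_eventuallyEq ?_
    filter_upwards [isOpen_openInterval.mem_nhds ht] with x hx using hfl x hx
  have hfl' : ∀ {l : Filter ℝ} {l' : Filter ℝ}, Tendsto u l l' → Tendsto y l' (𝓝 0) →
      (∀ᶠ t in l, t ∈ openInterval α β) → Tendsto (flux p d u) l (𝓝 0) := by
    intro l l' h1 h2 h3
    have := (h2.comp h1).neg
    rw [neg_zero] at this
    refine this.congr' ?_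
    filter_upwards [h3] with t ht using (hfl t ht).symm
  obtain ⟨t, ht⟩ := nonempty_openInterval hαβ
  refine ⟨α, β, u, hαβ, contDiffOn_one_of_hasDerivAt isOpen_openInterval hud
    (hrc.comp huc hu01).neg, hu01, contDiffOn_one_of_hasDerivAt isOpen_openInterval hfld ?_, ?_,
    huα.mono_right nhdsWithin_le_nhds, huβ.mono_right nhdsWithin_le_nhds,
    hfl' huα hy.tendsto_one ((eventually_mem_rightLimit ht).mono fun _ h => h.1),
    hfl' huβ hy.tendsto_zero ((eventually_mem_leftLimit ht).mono fun _ h => h.1)⟩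
  · have h1 : ContinuousOn (fun v => -(((c * g v - f v) - ρ v * d v ^ (1 / (p - 1)) *
        y v ^ (-(1 / (p - 1)))) * -(y v / d v) ^ (1 / (p - 1)))) (Ioo 0 1) :=
      ((((H.continuousOn_drift c).mono Ioo_subset_Icc_self).sub (H.continuousOn_weight.mul
        (hyc.rpow_const fun v hv => Or.inl (hy.pos hv).ne'))).mul hrc.neg).neg
    exact h1.comp huc hu01
  · intro t ht
    have hd := H.d_pos _ (hu01 t ht)
    have hy0 := hy.pos (hu01 t ht)
    have hds := (Real.rpow_pos_of_pos hd (1 / (p - 1))).ne'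
    have hys := (Real.rpow_pos_of_pos hy0 (1 / (p - 1))).ne'
    rw [(hfld t ht).deriv, (hud t ht).deriv, Real.rpow_neg hy0.le, Real.div_rpow hy0.le hd.le]
    field_simp
    ring

/-! ### The slope at `0` and the minimal speed -/

variable {y : ℝ → ℝ}

lemma tendsto_nhdsGT_zero_of_continuousOn {h : ℝ → ℝ} (hh : ContinuousOn h (Icc 0 1)) :
    Tendsto h (𝓝[>] 0) (𝓝 (h 0)) :=
  (hh 0 (left_mem_Icc.2 zero_le_one)).tendsto.mono_left (nhdsWithin_le_of_mem
    (mem_of_superset Ioo_mem_nhdsGT_zero Ioo_subset_Icc_self))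

lemma StructuralHypotheses.tendsto_drift (H : StructuralHypotheses p f g ρ d) (c : ℝ) :
    Tendsto (fun v => c * g v - f v) (𝓝[>] 0) (𝓝 (c * g 0 - f 0)) :=
  tendsto_nhdsGT_zero_of_continuousOn (H.continuousOn_drift c)

lemma StructuralHypotheses.tendsto_ρ (H : StructuralHypotheses p f g ρ d) :
    Tendsto ρ (𝓝[>] 0) (𝓝 0) := by
  simpa [H.ρ_zero] using tendsto_nhdsGT_zero_of_continuousOn H.continuousOn_ρ

lemma drift_nonneg_of_mem_admissibleSpeeds (H : StructuralHypotheses p f g ρ d)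
    (hc : c ∈ admissibleSpeeds p f g ρ d) : 0 ≤ c * g 0 - f 0 := by
  obtain ⟨α, β, u, hu⟩ := hc
  obtain ⟨y, hy, -⟩ := hu.exists_isProfile H
  exact hy.limit_nonneg H.weight_pos (H.tendsto_drift c)

/-- Without a lower bound the real `sInf` would be the default value `0`, and `minimalSpeed` would
not bound the admissible speeds from below. -/
lemma bddBelow_admissibleSpeeds (H : StructuralHypotheses p f g ρ d) :
    BddBelow (admissibleSpeeds p f g ρ d) := by
  refine ⟨f 0 / g 0, fun c hc => ?_⟩
  rw [div_le_iff₀ H.g_zero_pos]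
  linarith [drift_nonneg_of_mem_admissibleSpeeds H hc]

/-- The slope at `0` of the profile of minimal speed is maximal. -/
lemma IsProfile.tendsto_div_of_eq_minimalSpeed (H : StructuralHypotheses p f g ρ d)
    (hy : IsProfile (1 / (p - 1)) (fun v => c * g v - f v) (fun v => ρ v * d v ^ (1 / (p - 1))) y)
    (hqs : Tendsto (fun v => ρ v * d v ^ (1 / (p - 1)) / v ^ (1 / (p - 1))) (𝓝[>] 0) (𝓝 0))
    (hc : c = minimalSpeed p f g ρ d) :
    Tendsto (fun v => y v / v) (𝓝[>] 0) (𝓝 (c * g 0 - f 0)) := by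
  rcases (hy.limit_nonneg H.weight_pos (H.tendsto_drift c)).eq_or_lt with h0 | h0
  · rw [← h0]
    refine hy.tendsto_div_zero H.weight_pos ?_
    simpa only [← h0] using H.tendsto_drift c
  by_contra hlim
  obtain ⟨η, hη, hex⟩ := hy.exists_perturbation H.one_div_pos H.continuousOn_weight H.weight_pos
    (H.tendsto_drift c) h0 hqs hlim
  obtain ⟨M, hM⟩ := isCompact_Icc.exists_bound_of_continuousOn H.continuousOn_g
  have hM0 : 0 ≤ M := (norm_nonneg _).trans (hM 0 (left_mem_Icc.2 zero_le_one))
  -- Lowering the speed by `η / (M + 1)` changes the drift by at most `η`, since `|g| ≤ M`.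
  have hδ : 0 < η / (M + 1) := by positivity
  obtain ⟨z, hz⟩ := hex (fun v => (c - η / (M + 1)) * g v - f v)
    ((H.continuousOn_drift _).mono Ioo_subset_Icc_self) (fun v hv => by
      rw [show (c - η / (M + 1)) * g v - f v - (c * g v - f v) = -(η / (M + 1) * g v) by ring,
        abs_neg, abs_mul, abs_of_pos hδ]
      calc η / (M + 1) * |g v| ≤ η / (M + 1) * (M + 1) := by
            gcongr
            exact (hM v (Ioo_subset_Icc_self hv)).trans (by linarith)
        _ = η := div_mul_cancel₀ _ (by positivity))
  have := csInf_le (bddBelow_admissibleSpeeds H) (hz.exists_isTravelingWave H)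
  rw [hc, minimalSpeed] at this
  linarith

lemma exists_admissibleSpeed_lt (hu : IsTravelingWave p f g ρ d c α β u)
    (hc : minimalSpeed p f g ρ d < c) : ∃ c₁ ∈ admissibleSpeeds p f g ρ d, c₁ < c :=
  exists_lt_of_csInf_lt ⟨c, α, β, u, hu⟩ hc

lemma drift_pos_of_minimalSpeed_lt (H : StructuralHypotheses p f g ρ d)
    (hu : IsTravelingWave p f g ρ d c α β u) (hc : minimalSpeed p f g ρ d < c) :
    0 < c * g 0 - f 0 := by
  obtain ⟨c₁, hc₁, hlt⟩ := exists_admissibleSpeed_lt hu hc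
  have := drift_nonneg_of_mem_admissibleSpeeds H hc₁
  have := mul_lt_mul_of_pos_right hlt H.g_zero_pos
  linarith

/-- The slope at `0` of the profile of a non-minimal speed is not maximal. -/
lemma IsProfile.not_tendsto_div_of_minimalSpeed_lt (H : StructuralHypotheses p f g ρ d)
    (hu : IsTravelingWave p f g ρ d c α β u)
    (hy : IsProfile (1 / (p - 1)) (fun v => c * g v - f v) (fun v => ρ v * d v ^ (1 / (p - 1))) y)
    (hc : minimalSpeed p f g ρ d < c) :
    ¬ Tendsto (fun v => y v / v) (𝓝[>] 0) (𝓝 (c * g 0 - f 0)) := by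
  obtain ⟨c₁, ⟨α₁, β₁, u₁, hu₁⟩, hlt⟩ := exists_admissibleSpeed_lt hu hc
  obtain ⟨z, hz, -⟩ := hu₁.exists_isProfile H
  have hdiff : (fun v => (c * g v - f v) - (c₁ * g v - f v)) = fun v => (c - c₁) * g v := by
    ext v
    ring
  refine hy.not_tendsto_div H.one_div_pos hz H.weight_pos (H.tendsto_drift c₁) ?_ ?_ ?_
  · have := mul_lt_mul_of_pos_right hlt H.g_zero_pos
    linarith
  · rw [hdiff]
    exact continuousOn_const.mul H.continuousOn_g
  · intro v hv
    rw [hdiff, intervalIntegral.integral_const_mul]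
    exact mul_pos (sub_pos.2 hlt) (H.integral_g_pos v hv)

/-- Only small `ε` are required, because `ε v` serves as a barrier only for `ε < H`. -/
lemma tendsto_div_zero_of_forall_le {w : ℝ → ℝ} (hy : ∀ᶠ v in 𝓝[>] (0 : ℝ), 0 < y v)
    (hw : ∀ᶠ v in 𝓝[>] (0 : ℝ), 0 < w v) {K : ℝ} (hK : 0 < K)
    (hle : ∀ ε, 0 < ε → ε < K → ∀ᶠ v in 𝓝[>] (0 : ℝ), y v ≤ ε * w v) :
    Tendsto (fun v => y v / w v) (𝓝[>] 0) (𝓝 0) := by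
  refine tendsto_order.2 ⟨fun ε hε => ?_, fun ε hε => ?_⟩
  · filter_upwards [hy, hw] with v h1 h2 using hε.trans (div_pos h1 h2)
  · obtain ⟨ε', h1, h2⟩ := exists_between (lt_min hε hK)
    filter_upwards [hle ε' h1 (h2.trans_le (min_le_right _ _)), hw] with v h3 h4
    rw [div_lt_iff₀ h4]
    exact h3.trans_lt (mul_lt_mul_of_pos_right (h2.trans_le (min_le_left _ _)) h4)

lemma StructuralHypotheses.eventually_d_pos (H : StructuralHypotheses p f g ρ d) :
    ∀ᶠ v in 𝓝[>] 0, 0 < d v := by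
  filter_upwards [Ioo_mem_nhdsGT_zero] with v hv using H.d_pos v hv

lemma IsProfile.eventually_pos {s : ℝ} {h q : ℝ → ℝ} (hy : IsProfile s h q y) :
    ∀ᶠ v in 𝓝[>] 0, 0 < y v := by
  filter_upwards [Ioo_mem_nhdsGT_zero] with v hv using hy.pos hv

/-- The quotient is `ρ (d/v)^(1/(p-1))`, and `ρ → 0`. This is the hypothesis of the slope dichotomy.
-/
lemma StructuralHypotheses.tendsto_weight_div (H : StructuralHypotheses p f g ρ d) {D : ℝ}
    (hD : Tendsto (fun v => d v / v) (𝓝[>] 0) (𝓝 D)) :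
    Tendsto (fun v => ρ v * d v ^ (1 / (p - 1)) / v ^ (1 / (p - 1))) (𝓝[>] 0) (𝓝 0) := by
  have := H.tendsto_ρ.mul (hD.rpow_const (p := 1 / (p - 1)) (Or.inr H.one_div_pos.le))
  rw [zero_mul] at this
  refine this.congr' ?_
  filter_upwards [H.eventually_d_pos, self_mem_nhdsWithin] with v h1 h2
  rw [Real.div_rpow h1.le (le_of_lt h2), mul_div_assoc]

/-- Below the maximal slope, a profile is `o(d)` at `0` if `d' → 0`. -/
lemma IsProfile.tendsto_div_diffusion (H : StructuralHypotheses p f g ρ d)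
    (hy : IsProfile (1 / (p - 1)) (fun v => c * g v - f v) (fun v => ρ v * d v ^ (1 / (p - 1))) y)
    (hd' : Tendsto (deriv d) (𝓝[>] 0) (𝓝 0)) (hpos : 0 < c * g 0 - f 0)
    (hlim : ¬ Tendsto (fun v => y v / v) (𝓝[>] 0) (𝓝 (c * g 0 - f 0))) :
    Tendsto (fun v => y v / d v) (𝓝[>] 0) (𝓝 0) := by
  refine tendsto_div_zero_of_forall_le hy.eventually_pos H.eventually_d_pos one_pos
    fun ε hε _ => ?_
  -- The barrier is `ε d`: its slope `ε d'` tends to `0 < H`, and `q (ε d)^(-s) = ε^(-s) ρ → 0`.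
  refine (hy.eventually_le_or_tendsto_div H.one_div_pos H.weight_pos (H.tendsto_drift c)
    (b := fun v => ε * d v) (b' := fun v => ε * deriv d v) (K := (c * g 0 - f 0) / 2)
    ?_ ?_ ?_ (half_lt_self hpos) ?_).resolve_right hlim
  · filter_upwards [H.eventually_d_pos] with v hv using mul_pos hε hv
  · filter_upwards [Ioo_mem_nhdsGT_zero] with v hv
    exact (((H.contDiffOn_d.differentiableOn (by simp)).differentiableAt
      (isOpen_Ioo.mem_nhds hv)).hasDerivAt).const_mul ε
  · have : Tendsto (fun v => ε * deriv d v) (𝓝[>] 0) (𝓝 0) := by simpa using hd'.const_mul ε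
    exact (this.eventually_lt_const (half_pos hpos)).mono fun v hv => hv.le
  · have := H.tendsto_ρ.mul_const (ε ^ (-(1 / (p - 1))))
    rw [zero_mul] at this
    refine this.congr' ?_
    filter_upwards [H.eventually_d_pos] with v hv
    have := (Real.rpow_pos_of_pos hv (1 / (p - 1))).ne'
    rw [Real.mul_rpow hε.le hv.le, Real.rpow_neg hv.le]
    field_simp

lemma StructuralHypotheses.tendsto_d_div (H : StructuralHypotheses p f g ρ d)
    (hd : Tendsto d (𝓝[>] 0) (𝓝 0)) (hd' : Tendsto (deriv d) (𝓝[>] 0) (𝓝 0)) :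
    Tendsto (fun v => d v / v) (𝓝[>] 0) (𝓝 0) := by
  refine HasDerivAt.lhopital_zero_nhdsGT (f' := deriv d) (g' := fun _ => 1) ?_
    (Eventually.of_forall fun v => hasDerivAt_id v) (by simp) hd
    (tendsto_nhdsWithin_of_tendsto_nhds tendsto_id) (by simpa using hd')
  filter_upwards [Ioo_mem_nhdsGT_zero] with v hv
  exact ((H.contDiffOn_d.differentiableOn (by simp)).differentiableAt
    (isOpen_Ioo.mem_nhds hv)).hasDerivAt

lemma IsTravelingWave.tendsto_deriv (hu : IsTravelingWave p f g ρ d c α β u) {F : ℝ → ℝ}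
    {l : Filter ℝ} (hF : ∀ t ∈ openInterval α β, deriv u t = -F (u t))
    (hl : Tendsto (fun v => -F v) (𝓝[>] 0) l) : Tendsto (deriv u) (leftLimit β) l := by
  obtain ⟨t, ht⟩ := nonempty_openInterval hu.lt
  refine (hl.comp hu.tendsto_nhdsGT).congr' ?_
  filter_upwards [eventually_mem_leftLimit ht] with x hx using (hF x hx.1).symm

end TravelingWaves

end PLaplaceWave

/-! ### The limit of `u'` in the four cases -/

open PLaplaceWave in
theorem theorem5p3 (p : ℝ) (f g ρ d : ℝ → ℝ)
    (H : PLaplaceWave.StructuralHypotheses p f g ρ d)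
    (ℓ₀ : ℝ)
    (hℓ₀ : Tendsto (fun v : ℝ => ρ v * (d v ^ (1 / (p - 1)) / v ^ (1 / (p - 1))))
      (𝓝[>] 0) (𝓝 ℓ₀))
    (c : ℝ) (hc : PLaplaceWave.minimalSpeed p f g ρ d ≤ c)
    (α β : EReal) (u : ℝ → ℝ)
    (hu : PLaplaceWave.IsTravelingWave p f g ρ d c α β u) :
    -- the lower limit of `d` at `0⁺`, taken in `[-∞, +∞]`, is positive
    (0 < liminf (fun v : ℝ => (d v : EReal)) (𝓝[>] 0) →
      Tendsto (deriv u) (PLaplaceWave.leftLimit β) (𝓝 0)) ∧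
    -- `d(0⁺) = 0` and `d(v)/v → +∞`
    (Tendsto d (𝓝[>] 0) (𝓝 0) → Tendsto (fun v : ℝ => d v / v) (𝓝[>] 0) atTop →
      Tendsto (deriv u) (PLaplaceWave.leftLimit β) (𝓝 0)) ∧
    -- `d(0⁺) = 0` and `d(v)/v → D` with `0 < D < +∞`
    (∀ D : ℝ, 0 < D → Tendsto d (𝓝[>] 0) (𝓝 0) →
      Tendsto (fun v : ℝ => d v / v) (𝓝[>] 0) (𝓝 D) →
        (c = PLaplaceWave.minimalSpeed p f g ρ d →
          Tendsto (deriv u) (PLaplaceWave.leftLimit β)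
            (𝓝 (-(((PLaplaceWave.minimalSpeed p f g ρ d * g 0 - f 0) / D) ^
              (1 / (p - 1)))))) ∧
        (PLaplaceWave.minimalSpeed p f g ρ d < c →
          Tendsto (deriv u) (PLaplaceWave.leftLimit β) (𝓝 0))) ∧
    -- `d(0⁺) = 0`, the derivative of `d` tends to `0` at `0⁺`, and `c g(0) ≠ f(0)`
    (Tendsto d (𝓝[>] 0) (𝓝 0) → Tendsto (deriv d) (𝓝[>] 0) (𝓝 0) →
      c * g 0 - f 0 ≠ 0 →
        (c = PLaplaceWave.minimalSpeed p f g ρ d →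
          Tendsto (deriv u) (PLaplaceWave.leftLimit β) atBot) ∧
        (PLaplaceWave.minimalSpeed p f g ρ d < c →
          Tendsto (deriv u) (PLaplaceWave.leftLimit β) (𝓝 0))) := by
  obtain ⟨y, hy, hyu⟩ := hu.exists_isProfile H
  have hlim : ∀ {L : ℝ}, Tendsto (fun v => y v / d v) (𝓝[>] 0) (𝓝 L) →
      Tendsto (deriv u) (leftLimit β) (𝓝 (-(L ^ (1 / (p - 1))))) := fun h =>
    hu.tendsto_deriv hyu (h.rpow_const (Or.inr H.one_div_pos.le)).neg
  have hlim0 : Tendsto (fun v => y v / d v) (𝓝[>] 0) (𝓝 0) →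
      Tendsto (deriv u) (leftLimit β) (𝓝 0) := fun h => by
    simpa only [Real.zero_rpow H.one_div_pos.ne', neg_zero] using hlim h
  have hdiv : ∀ᶠ v in 𝓝[>] 0, y v / v / (d v / v) = y v / d v := by
    filter_upwards [self_mem_nhdsWithin] with v hv
    exact div_div_div_cancel_right₀ (ne_of_gt hv) _ _
  refine ⟨fun h => hlim0 ?_, fun _ h => hlim0 ?_, fun D hD hd hdD => ?_, fun hd hd' hne => ?_⟩
  -- Eventually `d > m > 0`, so `y / d ≤ y / m → 0`.
  · obtain ⟨m, hm0, hm⟩ := EReal.lt_iff_exists_real_btwn.1 h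
    have hm0 : 0 < m := EReal.coe_pos.1 hm0
    have hym : Tendsto (fun v => y v / m) (𝓝[>] 0) (𝓝 0) := by
      simpa using hy.tendsto_zero.div_const m
    refine squeeze_zero' ?_ ?_ hym
    · filter_upwards [hy.eventually_pos, H.eventually_d_pos] with v h1 h2 using (div_pos h1 h2).le
    · filter_upwards [hy.eventually_pos, eventually_lt_of_lt_liminf hm] with v h1 h2
      exact div_le_div_of_nonneg_left h1.le hm0 (EReal.coe_lt_coe_iff.1 h2).le
  -- Near `0`, `y ≤ K v`, so `y / d ≤ K / (d / v) → 0`.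
  · obtain ⟨K, hK⟩ := exists_gt (c * g 0 - f 0)
    refine squeeze_zero' ?_ ?_ (h.const_div_atTop K)
    · filter_upwards [hy.eventually_pos, H.eventually_d_pos] with v h1 h2 using (div_pos h1 h2).le
    · filter_upwards [hdiv, hy.eventually_le_mul H.weight_pos (H.tendsto_drift c) hK,
        H.eventually_d_pos, self_mem_nhdsWithin] with v h1 h2 h3 h4
      have h4 : 0 < v := h4
      rw [← h1]
      gcongr
      rwa [div_le_iff₀ h4]
  · have hqs := H.tendsto_weight_div hdD
    refine ⟨fun hcc => ?_, fun hcc => hlim0 ?_⟩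
    · rw [← hcc]
      exact hlim (((hy.tendsto_div_of_eq_minimalSpeed H hqs hcc).div hdD hD.ne').congr' hdiv)
    · have hpos := drift_pos_of_minimalSpeed_lt H hu hcc
      have hnot := hy.not_tendsto_div_of_minimalSpeed_lt H hu hcc
      -- With slope `H` excluded, `y ≤ ε v` near `0` for every `ε < H`, so the slope is `0`.
      have h0 := tendsto_div_zero_of_forall_le (w := fun v => v) hy.eventually_pos
        self_mem_nhdsWithin hpos fun ε h1 h2 => (hy.eventually_le_mul_or_tendsto_div H.one_div_pos
          H.weight_pos (H.tendsto_drift c) hqs h1 h2).resolve_right hnot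
      simpa using (h0.div hdD hD.ne').congr' hdiv
  · have hd0 := H.tendsto_d_div hd hd'
    have hpos : 0 < c * g 0 - f 0 := lt_of_le_of_ne
      (hy.limit_nonneg H.weight_pos (H.tendsto_drift c)) hne.symm
    refine ⟨fun hcc => ?_, fun hcc => hlim0 (hy.tendsto_div_diffusion H hd' hpos
      (hy.not_tendsto_div_of_minimalSpeed_lt H hu hcc))⟩
    have h1 := hy.tendsto_div_of_eq_minimalSpeed H (H.tendsto_weight_div hd0) hcc
    have h2 : Tendsto (fun v => d v / v) (𝓝[>] 0) (𝓝[>] 0) := by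
      refine tendsto_nhdsWithin_iff.2 ⟨hd0, ?_⟩
      filter_upwards [H.eventually_d_pos, self_mem_nhdsWithin] with v h3 h4 using div_pos h3 h4
    -- `y / v → H > 0` while `d / v → 0⁺`, so `y / d → +∞`.
    have h3 := (h1.pos_mul_atTop hpos h2.inv_tendsto_nhdsGT_zero).congr' hdiv
    exact hu.tendsto_deriv hyu
      (tendsto_neg_atTop_atBot.comp ((tendsto_rpow_atTop H.one_div_pos).comp h3))
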